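/- Let $X$ be a closed manifold, i.e. a compact Hausdorff smooth manifold without boundary, of dimension $n\ge 0$, equipped with a smooth positive density $|dx|$ (a measure which in every smooth chart is a smooth positive function times Lebesgue measure), and let $L^2=L^2(X,|dx|;\mathbb{C})$. Let $P$ be a linear differential operator of degree at most $1$ on $C^\infty(X,\mathbb{C})$ with smooth complex coefficients, i.e. a $\mathbb{C}$-linear map $C^\infty(X,\mathbb{C})\to C^\infty(X,\mathbb{C})$ which in every smooth chart has the form $P=\sum_{j=1}^n a_j\partial_j+b$ with $a_j,b$ smooth and complex-valued. Then: 1. If $u,v\in L^2$ and $Pu=v$ in the sense of distributions, then there is a sequence $u_j\in C^\infty(X,\mathbb{C})$ such that $u_j\to u$ and $Pu_j\to v$ in $L^2$. Here $Pu=v$ in the sense of distributions means that in every smooth chart, with $P=\sum_j a_j\partial_j+b$ in that chart, $\int u\,\bigl(-\sum_j\partial_j(a_j\varphi)+b\varphi\bigr)\,dy=\int v\,\varphi\,dy$ for every smooth $\varphi$ with compact support in the range of the chart. 2. If $P$ is formally self-adjoint, i.e. $\int_X Pu\,\overline{v}\,|dx|=\int_X u\,\overline{Pv}\,|dx|$ for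 all $u,v\in C^\infty(X,\mathbb{C})$, then $P$ with domain $C^\infty(X,\mathbb{C})$ is essentially self-adjoint in $L^2$: it is densely defined, and the graph of its Hilbert space adjoint $P^\star$ is the closure in $L^2\times L^2$ of the graph of $P$. -/

import Mathlib

open MeasureTheory Set Filter Topology
open scoped Manifold ContDiff LinearPMap

noncomputable section

namespace FirstOrder

/-- The complex vector space `C^∞(M, ℂ)` of smooth complex-valued functions on an `n`-manifold. -/
def Smooth (n : ℕ) (M : Type*) [TopologicalSpace M] [ChartedSpace (EuclideanSpace ℝ (Fin n)) M] :
    Submodule ℂ (M → ℂ) where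
  carrier := {f | ContMDiff (𝓡 n) 𝓘(ℝ, ℂ) ∞ f}
  add_mem' hf hg := ContMDiff.add hf hg
  zero_mem' := contMDiff_const
  smul_mem' c _ hf :=
    ((contDiff_const (c := c)).mul (contDiff_id (𝕜 := ℝ) (E := ℂ))).contMDiff.comp hf

section

variable {n : ℕ} {M : Type*} [TopologicalSpace M] [ChartedSpace (EuclideanSpace ℝ (Fin n)) M]

/-- In the chart `e`, the operator `P` is `∑ j, a j ∂_j + b` with coefficients that are smooth
on the range of the chart. -/
structure IsLocalForm (P : Smooth n M →ₗ[ℂ] Smooth n M)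
    (e : OpenPartialHomeomorph M (EuclideanSpace ℝ (Fin n)))
    (a : Fin n → EuclideanSpace ℝ (Fin n) → ℂ) (b : EuclideanSpace ℝ (Fin n) → ℂ) : Prop where
  smooth_a : ∀ j, ContDiffOn ℝ ∞ (a j) e.target
  smooth_b : ContDiffOn ℝ ∞ b e.target
  apply_eq : ∀ (f : Smooth n M), ∀ y ∈ e.target,
    (P f).1 (e.symm y) =
      ∑ j, a j y * fderiv ℝ (fun z => f.1 (e.symm z)) y (EuclideanSpace.single j 1)
        + b y * f.1 (e.symm y)

/-- `P` is a differential operator of degree (at most) one with smooth coefficients. -/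
def IsDiffOpDegreeOne (P : Smooth n M →ₗ[ℂ] Smooth n M) : Prop :=
  ∀ e ∈ IsManifold.maximalAtlas (𝓡 n) ∞ M, ∃ a b, IsLocalForm P e a b

/-- `P u = v` in the sense of Schwartz distributions, for functions `u`, `v` on `M`: in every chart,
where `P = ∑ j, a j ∂_j + b`, one has `∫ u (-∑ j, ∂_j (a j φ) + b φ) = ∫ v φ` (Lebesgue integrals in
the coordinates) for all smooth `φ` with compact support in the range of the chart. -/
def DistribEq (P : Smooth n M →ₗ[ℂ] Smooth n M) (u v : M → ℂ) : Prop :=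
  ∀ e ∈ IsManifold.maximalAtlas (𝓡 n) ∞ M, ∀ a b, IsLocalForm P e a b →
    ∀ φ : EuclideanSpace ℝ (Fin n) → ℂ, ContDiff ℝ ∞ φ → HasCompactSupport φ →
      tsupport φ ⊆ e.target →
      ∫ y, u (e.symm y) *
          (-(∑ j, fderiv ℝ (fun z => a j z * φ z) y (EuclideanSpace.single j 1)) + b y * φ y)
        = ∫ y, v (e.symm y) * φ y

variable [MeasurableSpace M]

variable (n) in
/-- The measure `μ` is (integration against) a smooth positive density: in each chart of the smooth
structure it is a smooth positive function times Lebesgue measure. -/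
def IsSmoothDensity (μ : Measure M) : Prop :=
  ∀ e ∈ IsManifold.maximalAtlas (𝓡 n) ∞ M, ∃ ρ : EuclideanSpace ℝ (Fin n) → ℝ,
    ContDiffOn ℝ ∞ ρ e.target ∧ (∀ y ∈ e.target, 0 < ρ y) ∧
    (μ.restrict e.source).map e =
      (volume.restrict e.target).withDensity (fun y => ENNReal.ofReal (ρ y))

/-- `∫ (P u) v̄ = ∫ u (conj (P v))` for all smooth `u`, `v`. -/
def IsFormallySelfAdjoint (μ : Measure M) (P : Smooth n M →ₗ[ℂ] Smooth n M) : Prop :=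
  ∀ u v : Smooth n M,
    ∫ x, (P u).1 x * (starRingEnd ℂ) (v.1 x) ∂μ = ∫ x, u.1 x * (starRingEnd ℂ) ((P v).1 x) ∂μ

variable [BorelSpace M] [IsManifold (𝓡 n) ∞ M]

theorem IsSmoothDensity.measure_image {μ : Measure M} {e : OpenPartialHomeomorph M
    (EuclideanSpace ℝ (Fin n))} {ρ : EuclideanSpace ℝ (Fin n) → ℝ}
    (h : (μ.restrict e.source).map e =
      (volume.restrict e.target).withDensity (fun y => ENNReal.ofReal (ρ y)))
    {s : Set (EuclideanSpace ℝ (Fin n))} (hs : MeasurableSet s) (hst : s ⊆ e.target) :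
    μ (e.source ∩ e ⁻¹' s) = ∫⁻ y in s, ENNReal.ofReal (ρ y) := by
  have he : AEMeasurable e (μ.restrict e.source) :=
    e.continuousOn.aemeasurable e.open_source.measurableSet
  have h2 := congrArg (fun ν => ν s) h
  rw [Measure.map_apply_of_aemeasurable he hs, withDensity_apply _ hs,
    Measure.restrict_restrict hs, inter_eq_left.2 hst,
    Measure.restrict_apply' e.open_source.measurableSet] at h2
  rw [inter_comm, h2]

theorem IsSmoothDensity.isFiniteMeasure [CompactSpace M] {μ : Measure M}
    (hμ : IsSmoothDensity n μ) : IsFiniteMeasure μ := by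
  have : IsLocallyFiniteMeasure μ := by
    refine ⟨fun x => ?_⟩
    let e := chartAt (EuclideanSpace ℝ (Fin n)) x
    have hx : x ∈ e.source := mem_chart_source _ x
    obtain ⟨ρ, hρ, -, h⟩ := hμ e (IsManifold.chart_mem_maximalAtlas x)
    obtain ⟨K, hK, hxK, hKt⟩ := exists_compact_subset e.open_target (e.map_source hx)
    refine ⟨e.source ∩ e ⁻¹' K, ?_, ?_⟩
    · exact inter_mem (e.open_source.mem_nhds hx)
        ((e.continuousAt hx).preimage_mem_nhds (mem_interior_iff_mem_nhds.1 hxK))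
    · rw [IsSmoothDensity.measure_image h hK.measurableSet hKt]
      exact ((hρ.continuousOn.mono hKt).integrableOn_compact hK).lintegral_lt_top
  exact ⟨isCompact_univ.measure_lt_top⟩

theorem IsSmoothDensity.isOpenPosMeasure {μ : Measure M}
    (hμ : IsSmoothDensity n μ) : μ.IsOpenPosMeasure := by
  refine ⟨fun U hU ⟨x, hxU⟩ h0 => ?_⟩
  let e := chartAt (EuclideanSpace ℝ (Fin n)) x
  have hx : x ∈ e.source := mem_chart_source _ x
  obtain ⟨ρ, hρ, hpos, h⟩ := hμ e (IsManifold.chart_mem_maximalAtlas x)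
  let V := e.target ∩ e.symm ⁻¹' U
  have hV : IsOpen V := e.isOpen_inter_preimage_symm hU
  have hVne : V.Nonempty := ⟨e x, e.map_source hx, by simpa [e.left_inv hx] using hxU⟩
  have hsub : e.source ∩ e ⁻¹' V ⊆ U := fun z hz => by
    simpa [e.left_inv hz.1] using hz.2.2
  have h1 : ∫⁻ y in V, ENNReal.ofReal (ρ y) = 0 := by
    rw [← IsSmoothDensity.measure_image h hV.measurableSet inter_subset_left]
    exact measure_mono_null hsub h0
  have hm : AEMeasurable (fun y => ENNReal.ofReal (ρ y)) (volume.restrict V) :=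
    ((hρ.continuousOn.mono inter_subset_left).aemeasurable hV.measurableSet).ennreal_ofReal
  rw [lintegral_eq_zero_iff' hm] at h1
  have h2 : ∀ᵐ y ∂(volume.restrict V), False := by
    filter_upwards [h1, ae_restrict_mem hV.measurableSet] with y hy hyV
    have := hpos y hyV.1
    simp only [Pi.zero_apply, ENNReal.ofReal_eq_zero] at hy
    linarith
  have h3 : volume V = 0 := by
    simpa using h2
  exact hV.measure_ne_zero volume hVne h3

variable [CompactSpace M]

theorem memLp_smooth {μ : Measure M} (hμ : IsSmoothDensity n μ) (f : Smooth n M) :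
    MemLp f.1 2 μ := by
  have := hμ.isFiniteMeasure
  have hc : Continuous f.1 := ContMDiff.continuous f.2
  obtain ⟨C, hC⟩ := isCompact_univ.exists_bound_of_continuousOn hc.continuousOn
  exact MemLp.of_bound hc.aestronglyMeasurable C (ae_of_all _ fun x => hC x (mem_univ x))

/-- The inclusion of `C^∞(M, ℂ)` in `L²(M, μ)`. -/
def toL2 {μ : Measure M} (hμ : IsSmoothDensity n μ) : Smooth n M →ₗ[ℂ] Lp ℂ 2 μ where
  toFun f := (memLp_smooth hμ f).toLp f.1
  map_add' _ _ := rfl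
  map_smul' _ _ := rfl

theorem toL2_injective {μ : Measure M} (hμ : IsSmoothDensity n μ) :
    Function.Injective (toL2 hμ) := by
  intro f g hfg
  have := hμ.isOpenPosMeasure
  have h : f.1 =ᵐ[μ] g.1 := 
    (MemLp.toLp_eq_toLp_iff (memLp_smooth hμ f) (memLp_smooth hμ g)).1 hfg
  exact Subtype.ext (Continuous.ae_eq_iff_eq μ (ContMDiff.continuous f.2)
    (ContMDiff.continuous g.2) |>.1 h)

/-- `P` as an unbounded operator on `L²(M, μ)` with domain `C^∞(M, ℂ)`. -/
def unbounded {μ : Measure M} (hμ : IsSmoothDensity n μ) (P : Smooth n M →ₗ[ℂ] Smooth n M) :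
    Lp ℂ 2 μ →ₗ.[ℂ] Lp ℂ 2 μ where
  domain := LinearMap.range (toL2 hμ)
  toFun := toL2 hμ ∘ₗ P ∘ₗ (LinearEquiv.ofInjective (toL2 hμ) (toL2_injective hμ)).symm.toLinearMap

end

/-- A densely defined operator is essentially self-adjoint if the graph of its adjoint is the
closure of its own graph. -/
def IsEssentiallySelfAdjoint {H : Type*} [NormedAddCommGroup H] [InnerProductSpace ℂ H]
    [CompleteSpace H] (T : H →ₗ.[ℂ] H) : Prop :=
  Dense (T.domain : Set H) ∧ T†.graph = T.graph.topologicalClosure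

end FirstOrder

end

/-!
A first-order operator `P` on a closed manifold has the same weak and strong extension in `L²`:
whenever `P u = v` weakly, `(u, v)` is a limit of pairs `(w, P w)` with `w` smooth. If `P` is also
formally self-adjoint, an element of the graph of the Hilbert space adjoint is a weak solution, so
the graph of the adjoint is contained in the closure of the graph of `P`; the opposite inclusion is
formal.

The analytic core is Friedrichs' lemma on a vector space (`exists_eLpNorm_commutator_le`). Let
`A = ∑ j, a j ∂_j + b` have smooth compactly supported coefficients, let `A U = V` weakly and let
`η_r` be an approximate identity. Then `A (U * η_r) - V * η_r` is given by an integral kernel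
dominated by a dilate of a fixed integrable function, because in
`(a j x - a j y) ∂_j η_r (x - y)` the Lipschitz bound on `a j` absorbs the derivative of `η_r`. By
Young's inequality the pairs `(U * η_r, A (U * η_r))` are bounded in `L² × L²`. Integrating by parts
against test functions, they converge weakly to `(U, V)`. A closed subspace is weakly closed, so
`(U, V)` lies in the norm closure of the graph of `A` (`exists_testFunction_approx`); weak
convergence of mollifiers is all that is needed.

On the manifold, `u` is split by a partition of unity. If `χ` is supported in a chart, then
`P (χ u) = χ v + [P, χ] u` weakly, where `[P, χ]` is multiplication by the function `P χ - χ P 1`,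
and the Euclidean result applies in the coordinates (`exists_smooth_approx_of_tsupport_subset`).
Summing over the partition, the commutators add up to `[P, 1] = 0`
(`mem_closure_graph_of_distribEq`).

For the adjoint, let `ρ` be the density in a chart. Testing the relation `⟪u, P w⟫ = ⟪v, w⟫` against
`w = φ̄ / ρ` gives the weak equation tested against `φ`, since formal self-adjointness identifies
`ρ` times the conjugate of `P w` with the transpose of `P` applied to `φ`
(`density_mul_conj_eq_transposeOp`).
-/

set_option linter.unusedSectionVars false

namespace FirstOrder

open scoped ENNReal NNReal InnerProductSpace

/-! ### Weak limits in closed convex sets -/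

theorem tendsto_inner_of_dense {H : Type*} [NormedAddCommGroup H] [InnerProductSpace ℂ H]
    {x : ℕ → H} {p : H} {C : ℝ} (hC : ∀ N, ‖x N‖ ≤ C) {D : Set H} (hD : Dense D)
    (h : ∀ y ∈ D, Tendsto (fun N => ⟪y, x N⟫_ℂ) atTop (𝓝 ⟪y, p⟫_ℂ)) (y : H) :
    Tendsto (fun N => ⟪y, x N⟫_ℂ) atTop (𝓝 ⟪y, p⟫_ℂ) := by
  rw [Metric.tendsto_atTop]
  intro ε hε
  have hB : 0 < C + ‖p‖ + 1 := by
    have := (norm_nonneg _).trans (hC 0)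
    positivity
  obtain ⟨d, hd, hyd⟩ := Metric.dense_iff.1 hD y (ε / 2 / (C + ‖p‖ + 1)) (by positivity)
  obtain ⟨N₀, hN₀⟩ := Metric.tendsto_atTop.1 (h d hyd) (ε / 2) (by positivity)
  refine ⟨N₀, fun N hN => ?_⟩
  have h1 := hN₀ N hN
  rw [dist_eq_norm, ← inner_sub_right] at h1 ⊢
  have h2 : ⟪y, x N - p⟫_ℂ = ⟪y - d, x N - p⟫_ℂ + ⟪d, x N - p⟫_ℂ := by
    rw [← inner_add_left, sub_add_cancel]
  have h3 : ‖⟪y - d, x N - p⟫_ℂ‖ ≤ ε / 2 := by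
    calc ‖⟪y - d, x N - p⟫_ℂ‖ ≤ ‖y - d‖ * ‖x N - p‖ := norm_inner_le_norm _ _
      _ ≤ (ε / 2 / (C + ‖p‖ + 1)) * (C + ‖p‖ + 1) := by
          gcongr
          · rw [← dist_eq_norm, dist_comm]
            exact (Metric.mem_ball.1 hd).le
          · linarith [norm_sub_le (x N) p, hC N]
      _ = ε / 2 := by field_simp
  rw [h2]
  linarith [norm_add_le ⟪y - d, x N - p⟫_ℂ ⟪d, x N - p⟫_ℂ]

/-- A closed subspace of `H × H` is weakly closed, and for bounded sequences weak convergence may be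
tested on a dense set. -/
theorem mem_closure_of_tendsto_inner {H : Type*} [NormedAddCommGroup H] [InnerProductSpace ℂ H]
    [CompleteSpace H] (G : Submodule ℂ (H × H)) {p : H × H} {x : ℕ → H × H} (hx : ∀ N, x N ∈ G)
    {C : ℝ} (hC : ∀ N, ‖x N‖ ≤ C) {D : Set H} (hD : Dense D)
    (h₁ : ∀ y ∈ D, Tendsto (fun N => ⟪y, (x N).1⟫_ℂ) atTop (𝓝 ⟪y, p.1⟫_ℂ))
    (h₂ : ∀ y ∈ D, Tendsto (fun N => ⟪y, (x N).2⟫_ℂ) atTop (𝓝 ⟪y, p.2⟫_ℂ)) :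
    p ∈ G.topologicalClosure := by
  by_contra hp
  have hconv : Convex ℝ (G.topologicalClosure : Set (H × H)) :=
    (G.topologicalClosure.restrictScalars ℝ).convex
  obtain ⟨f, s, hf, hs⟩ := RCLike.geometric_hahn_banach_closed_point (𝕜 := ℂ) hconv
    G.isClosed_topologicalClosure hp
  set y₁ := (InnerProductSpace.toDual ℂ H).symm (f.comp (ContinuousLinearMap.inl ℂ H H)) with hy₁
  set y₂ := (InnerProductSpace.toDual ℂ H).symm (f.comp (ContinuousLinearMap.inr ℂ H H)) with hy₂
  have hfy : ∀ q : H × H, f q = ⟪y₁, q.1⟫_ℂ + ⟪y₂, q.2⟫_ℂ := by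
    intro q
    rw [hy₁, hy₂, InnerProductSpace.toDual_symm_apply, InnerProductSpace.toDual_symm_apply]
    simp [← map_add]
  have hlim : Tendsto (fun N => f (x N)) atTop (𝓝 (f p)) := by
    simp only [hfy]
    exact (tendsto_inner_of_dense (fun N => (norm_fst_le (x N)).trans (hC N)) hD h₁ y₁).add
      (tendsto_inner_of_dense (fun N => (norm_snd_le (x N)).trans (hC N)) hD h₂ y₂)
  have hre := ((RCLike.continuous_re (K := ℂ)).tendsto (f p)).comp hlim
  have : RCLike.re (f p) ≤ s :=
    le_of_tendsto' hre fun N => (hf _ (G.le_topologicalClosure (hx N))).le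
  exact absurd hs this.not_gt

/-! ### Dilations and convolution estimates -/

section Dilation

variable {E : Type*} [NormedAddCommGroup E] [NormedSpace ℝ E]

/-- The dilation `z ↦ r ^ dim E • η (r z)`, which preserves integrals. -/
noncomputable def dilate (r : ℝ) (η : E → ℂ) (z : E) : ℂ :=
  (r : ℂ) ^ Module.finrank ℝ E * η (r • z)

theorem contDiff_dilate (r : ℝ) {η : E → ℂ} (hη : ContDiff ℝ ∞ η) :
    ContDiff ℝ ∞ (dilate r η) :=
  contDiff_const.mul (hη.comp (contDiff_const_smul r))

theorem hasCompactSupport_dilate {r : ℝ} (hr : 0 < r) {η : E → ℂ} (hη : HasCompactSupport η) :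
    HasCompactSupport (dilate r η) :=
  (hη.comp_smul hr.ne').mul_left

theorem fderiv_dilate (r : ℝ) {η : E → ℂ} (hη : ContDiff ℝ ∞ η) (z d : E) :
    fderiv ℝ (dilate r η) z d = (r : ℂ) ^ Module.finrank ℝ E * (r * fderiv ℝ η (r • z) d) := by
  have h1 : HasFDerivAt η (fderiv ℝ η (r • z)) (r • z) :=
    (hη.differentiable (by simp) _).hasFDerivAt
  have h2 : HasFDerivAt (fun z : E => r • z) (r • ContinuousLinearMap.id ℝ E) z :=
    (hasFDerivAt_id z).const_smul r
  have h3 := (h1.comp z h2).const_mul ((r : ℂ) ^ Module.finrank ℝ E)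
  have h4 : fderiv ℝ (dilate r η) z = _ := h3.fderiv
  rw [h4]
  simp

end Dilation

section Euclidean

variable {E : Type*} [NormedAddCommGroup E] [NormedSpace ℝ E] [FiniteDimensional ℝ E]
  [MeasureSpace E] [BorelSpace E] [(volume : Measure E).IsAddHaarMeasure]

/-- Young's inequality `‖U * k‖₂ ≤ ‖k‖₁ ‖U‖₂`, for any function dominated by the convolution. -/
theorem eLpNorm_two_le_of_le_convolution {U F : E → ℂ} {k : E → ℝ≥0∞}
    (hU : AEStronglyMeasurable U) (hk : Measurable k)
    (hF : ∀ x, ‖F x‖ₑ ≤ ∫⁻ y, ‖U y‖ₑ * k (x - y)) :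
    eLpNorm F 2 ≤ (∫⁻ z, k z) * eLpNorm U 2 := by
  set c := ∫⁻ z, k z with hc
  have hsub : ∀ x, ∫⁻ y, k (x - y) = c := fun x => lintegral_sub_left_eq_self k x
  have hpt : ∀ x, ‖F x‖ₑ ^ (2 : ℝ) ≤ c * ∫⁻ y, ‖U y‖ₑ ^ (2 : ℝ) * k (x - y) := by
    intro x
    have hkx : Measurable fun y => k (x - y) := hk.comp (measurable_const.sub measurable_id)
    -- Cauchy-Schwarz after writing `|U| k = (|U|² k)^{1/2} k^{1/2}`
    have h1 := ENNReal.lintegral_mul_norm_pow_le (μ := (volume : Measure E))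
      (f := fun y => ‖U y‖ₑ ^ (2 : ℝ) * k (x - y)) (g := fun y => k (x - y))
      ((hU.enorm.pow_const _).mul hkx.aemeasurable) hkx.aemeasurable
      (p := 1 / 2) (q := 1 / 2) (by norm_num) (by norm_num) (by norm_num)
    have h2 : ∀ y, (‖U y‖ₑ ^ (2 : ℝ) * k (x - y)) ^ (1 / 2 : ℝ) * k (x - y) ^ (1 / 2 : ℝ)
        = ‖U y‖ₑ * k (x - y) := by
      intro y
      rw [ENNReal.mul_rpow_of_nonneg _ _ (by norm_num), ← ENNReal.rpow_mul, mul_assoc,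
        ← ENNReal.rpow_add_of_nonneg _ _ (by norm_num) (by norm_num)]
      norm_num
    simp only [h2, hsub] at h1
    calc ‖F x‖ₑ ^ (2 : ℝ) ≤ ((∫⁻ y, ‖U y‖ₑ ^ (2 : ℝ) * k (x - y)) ^ (1 / 2 : ℝ)
          * c ^ (1 / 2 : ℝ)) ^ (2 : ℝ) := by
          gcongr
          exact (hF x).trans h1
      _ = c * ∫⁻ y, ‖U y‖ₑ ^ (2 : ℝ) * k (x - y) := by
          rw [ENNReal.mul_rpow_of_nonneg _ _ (by norm_num), ← ENNReal.rpow_mul, ← ENNReal.rpow_mul]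
          norm_num [mul_comm]
  have hint : ∫⁻ x, ‖F x‖ₑ ^ (2 : ℝ) ≤ c * (c * ∫⁻ y, ‖U y‖ₑ ^ (2 : ℝ)) := by
    have hmeas : AEMeasurable (Function.uncurry fun x y => ‖U y‖ₑ ^ (2 : ℝ) * k (x - y))
        ((volume : Measure E).prod volume) :=
      ((hU.enorm.pow_const _).comp_quasiMeasurePreserving Measure.quasiMeasurePreserving_snd).mul
        (hk.comp (measurable_fst.sub measurable_snd)).aemeasurable
    calc ∫⁻ x, ‖F x‖ₑ ^ (2 : ℝ) ≤ ∫⁻ x, c * ∫⁻ y, ‖U y‖ₑ ^ (2 : ℝ) * k (x - y) :=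
          lintegral_mono hpt
      _ = c * ∫⁻ x, ∫⁻ y, ‖U y‖ₑ ^ (2 : ℝ) * k (x - y) :=
          lintegral_const_mul'' _ hmeas.lintegral_prod_right'
      _ = c * ∫⁻ y, ∫⁻ x, ‖U y‖ₑ ^ (2 : ℝ) * k (x - y) := by
          rw [lintegral_lintegral_swap hmeas]
      _ = c * ∫⁻ y, ‖U y‖ₑ ^ (2 : ℝ) * c := by
          congr 2 with y
          rw [lintegral_const_mul _ (by fun_prop),
            lintegral_sub_right_eq_self k y]
      _ = c * (c * ∫⁻ y, ‖U y‖ₑ ^ (2 : ℝ)) := by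
          rw [lintegral_mul_const'' _ (hU.enorm.pow_const _), mul_comm c (∫⁻ y, _)]
  rw [eLpNorm_eq_lintegral_rpow_enorm_toReal (by norm_num) (by norm_num),
    eLpNorm_eq_lintegral_rpow_enorm_toReal (by norm_num) (by norm_num)]
  simp only [ENNReal.toReal_ofNat]
  calc (∫⁻ x, ‖F x‖ₑ ^ (2 : ℝ)) ^ (1 / 2 : ℝ)
      ≤ (c * (c * ∫⁻ y, ‖U y‖ₑ ^ (2 : ℝ))) ^ (1 / 2 : ℝ) := by gcongr
    _ = c * (∫⁻ y, ‖U y‖ₑ ^ (2 : ℝ)) ^ (1 / 2 : ℝ) := by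
        rw [← mul_assoc, ENNReal.mul_rpow_of_nonneg _ _ (by norm_num),
          ENNReal.mul_rpow_of_nonneg _ _ (by norm_num), ← ENNReal.rpow_add_of_nonneg _ _
          (by norm_num) (by norm_num)]
        norm_num

theorem lintegral_dilate {r : ℝ} (hr : 0 < r) (k : E → ℝ≥0∞) (hk : Measurable k) :
    ∫⁻ z, ENNReal.ofReal (r ^ Module.finrank ℝ E) * k (r • z) = ∫⁻ z, k z := by
  have h : ∫⁻ z, k (r • z) = ENNReal.ofReal |(r ^ Module.finrank ℝ E)⁻¹| * ∫⁻ z, k z := by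
    rw [← lintegral_map hk (measurable_const_smul r), Measure.map_addHaar_smul _ hr.ne',
      lintegral_smul_measure, smul_eq_mul]
  rw [lintegral_const_mul _ (by fun_prop), h, ← mul_assoc,
    ← ENNReal.ofReal_mul (by positivity), abs_of_pos (by positivity),
    mul_inv_cancel₀ (by positivity), ENNReal.ofReal_one, one_mul]

theorem integral_dilate_mul {r : ℝ} (hr : 0 < r) (η g : E → ℂ) :
    ∫ z, dilate r η z * g z = ∫ z, η z * g (r⁻¹ • z) := by
  have h := Measure.integral_comp_smul (volume : Measure E)
    (fun z => (r : ℂ) ^ Module.finrank ℝ E * (η z * g (r⁻¹ • z))) r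
  simp only [inv_smul_smul₀ hr.ne', integral_const_mul] at h
  have h2 : ∫ z, dilate r η z * g z
      = ∫ z, (r : ℂ) ^ Module.finrank ℝ E * (η (r • z) * g z) := by
    congr with z
    rw [dilate, mul_assoc]
  rw [h2, integral_const_mul, h, abs_of_pos (by positivity)]
  rw [Complex.real_smul]
  push_cast
  rw [← mul_assoc, inv_mul_cancel₀ (by exact_mod_cast (by positivity)), one_mul]

end Euclidean

/-! ### First-order operators on a vector space -/

section Operator

variable {E ι : Type*} [NormedAddCommGroup E] [NormedSpace ℝ E] [Fintype ι]

/-- The first-order operator `∑ j, a j ∂_{d j} + b`. -/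
noncomputable def firstOrderOp (d : ι → E) (a : ι → E → ℂ) (b : E → ℂ) (f : E → ℂ) (y : E) : ℂ :=
  ∑ j, a j y * fderiv ℝ f y (d j) + b y * f y

/-- The transpose `φ ↦ -∑ j, ∂_{d j} (a j φ) + b φ` of `∑ j, a j ∂_{d j} + b`. -/
noncomputable def transposeOp (d : ι → E) (a : ι → E → ℂ) (b : E → ℂ) (φ : E → ℂ) (y : E) : ℂ :=
  -(∑ j, fderiv ℝ (fun z => a j z * φ z) y (d j)) + b y * φ y

variable {d : ι → E} {a : ι → E → ℂ} {b : E → ℂ}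

theorem contDiff_fderiv_apply {f : E → ℂ} (hf : ContDiff ℝ ∞ f) (v : E) :
    ContDiff ℝ ∞ fun y => fderiv ℝ f y v :=
  (hf.fderiv_right (m := ∞) (by simp)).clm_apply contDiff_const

theorem hasCompactSupport_fderiv_apply {f : E → ℂ} (hf : HasCompactSupport f) (v : E) :
    HasCompactSupport fun y => fderiv ℝ f y v :=
  hf.fderiv_apply (𝕜 := ℝ) v

theorem contDiff_firstOrderOp (ha : ∀ j, ContDiff ℝ ∞ (a j)) (hb : ContDiff ℝ ∞ b) {f : E → ℂ}
    (hf : ContDiff ℝ ∞ f) : ContDiff ℝ ∞ (firstOrderOp d a b f) :=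
  (ContDiff.sum fun j _ => (ha j).mul (contDiff_fderiv_apply hf _)).add (hb.mul hf)

theorem contDiff_transposeOp (ha : ∀ j, ContDiff ℝ ∞ (a j)) (hb : ContDiff ℝ ∞ b) {f : E → ℂ}
    (hf : ContDiff ℝ ∞ f) : ContDiff ℝ ∞ (transposeOp d a b f) :=
  (ContDiff.sum fun j _ => contDiff_fderiv_apply ((ha j).mul hf) _).neg.add (hb.mul hf)

theorem firstOrderOp_eq_zero {f : E → ℂ} {y : E} (hy : y ∉ tsupport f) :
    firstOrderOp d a b f y = 0 := by
  have h : fderiv ℝ f y = 0 := image_eq_zero_of_notMem_tsupport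
    fun h => hy (tsupport_fderiv_subset ℝ h)
  simp [firstOrderOp, h, image_eq_zero_of_notMem_tsupport hy]

theorem transposeOp_eq_zero {f : E → ℂ} {y : E} (hy : y ∉ tsupport f) :
    transposeOp d a b f y = 0 := by
  have h : ∀ j, fderiv ℝ (fun z => a j z * f z) y = 0 := fun j =>
    image_eq_zero_of_notMem_tsupport fun h => hy
      (tsupport_mul_subset_right (tsupport_fderiv_subset ℝ h))
  simp [transposeOp, h, image_eq_zero_of_notMem_tsupport hy]

theorem hasCompactSupport_transposeOp {f : E → ℂ} (hf : HasCompactSupport f) :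
    HasCompactSupport (transposeOp d a b f) :=
  HasCompactSupport.intro hf fun _ => transposeOp_eq_zero

theorem firstOrderOp_add {f g : E → ℂ} (hf : ContDiff ℝ ∞ f) (hg : ContDiff ℝ ∞ g) :
    firstOrderOp d a b (f + g) = firstOrderOp d a b f + firstOrderOp d a b g := by
  ext y
  simp only [firstOrderOp, Pi.add_apply]
  rw [fderiv_add (hf.differentiable (by simp) y) (hg.differentiable (by simp) y)]
  simp only [add_apply, mul_add, Finset.sum_add_distrib]
  ring

theorem firstOrderOp_smul (c : ℂ) {f : E → ℂ} (hf : ContDiff ℝ ∞ f) :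
    firstOrderOp d a b (c • f) = c • firstOrderOp d a b f := by
  ext y
  simp only [firstOrderOp, Pi.smul_apply, smul_eq_mul]
  rw [fderiv_const_smul (hf.differentiable (by simp) y)]
  simp only [smul_apply, smul_eq_mul, mul_add, Finset.mul_sum]
  congr 1
  · exact Finset.sum_congr rfl fun j _ => by ring
  · ring

theorem transposeOp_apply (ha : ∀ j, ContDiff ℝ ∞ (a j)) {φ : E → ℂ} (hφ : ContDiff ℝ ∞ φ) (y : E) :
    transposeOp d a b φ y = ∑ j, -(a j y * fderiv ℝ φ y (d j))
      + (b y - ∑ j, fderiv ℝ (a j) y (d j)) * φ y := by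
  have h : ∀ j, fderiv ℝ (fun z => a j z * φ z) y (d j)
      = a j y * fderiv ℝ φ y (d j) + φ y * fderiv ℝ (a j) y (d j) := by
    intro j
    rw [fderiv_fun_mul ((ha j).differentiable (by simp) y) (hφ.differentiable (by simp) y)]
    simp
  simp only [transposeOp, h, Finset.sum_add_distrib, Finset.sum_neg_distrib, ← Finset.mul_sum]
  ring

variable [FiniteDimensional ℝ E] [MeasureSpace E] [BorelSpace E]
  [(volume : Measure E).IsAddHaarMeasure]

theorem integral_firstOrderOp_mul (ha : ∀ j, ContDiff ℝ ∞ (a j)) (hb : ContDiff ℝ ∞ b)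
    {f φ : E → ℂ} (hf : ContDiff ℝ ∞ f) (hφ : ContDiff ℝ ∞ φ) (hφc : HasCompactSupport φ) :
    ∫ y, firstOrderOp d a b f y * φ y = ∫ y, f y * transposeOp d a b φ y := by
  have hI : ∀ {g : E → ℂ}, Continuous g → HasCompactSupport g → Integrable g :=
    fun h h' => h.integrable_of_hasCompactSupport h'
  have haφ : ∀ j, ContDiff ℝ ∞ fun z => a j z * φ z := fun j => (ha j).mul hφ
  have hcj : ∀ j, HasCompactSupport fun z => a j z * φ z := fun j => hφc.mul_left
  have h1 : ∀ j, Integrable fun y => fderiv ℝ f y (d j) * (a j y * φ y) := fun j =>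
    hI ((contDiff_fderiv_apply hf _).continuous.mul (haφ j).continuous) (hcj j).mul_left
  have h2 : ∀ j, Integrable fun y => f y * fderiv ℝ (fun z => a j z * φ z) y (d j) := fun j =>
    hI (hf.continuous.mul (contDiff_fderiv_apply (haφ j) _).continuous)
      (hasCompactSupport_fderiv_apply (hcj j) _).mul_left
  have h2' : ∀ j, Integrable fun y => -(f y * fderiv ℝ (fun z => a j z * φ z) y (d j)) :=
    fun j => (h2 j).neg
  have h3 : Integrable fun y => b y * f y * φ y :=
    hI ((hb.mul hf).continuous.mul hφ.continuous) hφc.mul_left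
  have hparts : ∀ j, ∫ y, f y * fderiv ℝ (fun z => a j z * φ z) y (d j)
      = -∫ y, fderiv ℝ f y (d j) * (a j y * φ y) := fun j =>
    integral_mul_fderiv_eq_neg_fderiv_mul_of_integrable (h1 j) (h2 j)
      (hI (hf.continuous.mul (haφ j).continuous) (hcj j).mul_left)
      (fun x _ => hf.differentiable (by simp) x) (fun x _ => (haφ j).differentiable (by simp) x)
  calc ∫ y, firstOrderOp d a b f y * φ y
      = ∫ y, (∑ j, fderiv ℝ f y (d j) * (a j y * φ y)) + b y * f y * φ y := by
        congr with y
        rw [firstOrderOp, add_mul, Finset.sum_mul]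
        congr 1
        exact Finset.sum_congr rfl fun j _ => by ring
    _ = ∑ j, (∫ y, fderiv ℝ f y (d j) * (a j y * φ y)) + ∫ y, b y * f y * φ y := by
        rw [integral_add (integrable_finsetSum _ fun j _ => h1 j) h3,
          integral_finsetSum _ fun j _ => h1 j]
    _ = ∑ j, (∫ y, -(f y * fderiv ℝ (fun z => a j z * φ z) y (d j)))
          + ∫ y, b y * f y * φ y := by
        congr 1
        exact Finset.sum_congr rfl fun j _ => by rw [integral_neg, hparts j, neg_neg]
    _ = ∫ y, f y * transposeOp d a b φ y := by
        rw [← integral_finsetSum _ fun j _ => h2' j,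
          ← integral_add (integrable_finsetSum _ fun j _ => h2' j) h3]
        congr with y
        rw [transposeOp, mul_add, mul_neg, Finset.mul_sum, Finset.sum_neg_distrib]
        ring

/-- The function with integral one whose dilates form the mollifier. -/
theorem exists_mollifier : ∃ η : E → ℂ, ContDiff ℝ ∞ η ∧ HasCompactSupport η ∧ ∫ z, η z = 1 := by
  let B : ContDiffBump (0 : E) := ⟨1, 2, by norm_num, by norm_num⟩
  refine ⟨fun z => (B.normed volume z : ℂ), Complex.ofRealCLM.contDiff.comp B.contDiff_normed,
    B.hasCompactSupport_normed.comp_left (g := Complex.ofReal) Complex.ofReal_zero, ?_⟩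
  rw [integral_complex_ofReal, B.integral_normed, Complex.ofReal_one]

end Operator

/-! ### Mollification and Friedrichs' commutator estimate -/

section Mollify

variable {E ι : Type*} [NormedAddCommGroup E] [NormedSpace ℝ E] [Fintype ι]
  [FiniteDimensional ℝ E] [MeasureSpace E] [BorelSpace E] [(volume : Measure E).IsAddHaarMeasure]

/-- The mollification `U * η_r`, where `η_r` is the dilate of `η` of width `1 / r`. -/
noncomputable def mollify (r : ℝ) (η U : E → ℂ) : E → ℂ :=
  convolution U (dilate r η) (ContinuousLinearMap.mul ℝ ℂ) volume

variable {r : ℝ} {η U V : E → ℂ}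

theorem mollify_apply (x : E) : mollify r η U x = ∫ y, U y * dilate r η (x - y) := rfl

theorem contDiff_mollify (hr : 0 < r) (hη : ContDiff ℝ ∞ η) (hηc : HasCompactSupport η)
    (hU : LocallyIntegrable U) : ContDiff ℝ ∞ (mollify r η U) :=
  (hasCompactSupport_dilate hr hηc).contDiff_convolution_right (n := ⊤) _ hU
    (contDiff_dilate r hη)

theorem fderiv_mollify (hr : 0 < r) (hη : ContDiff ℝ ∞ η) (hηc : HasCompactSupport η)
    (hU : LocallyIntegrable U) (x v : E) :
    fderiv ℝ (mollify r η U) x v = ∫ y, U y * fderiv ℝ (dilate r η) (x - y) v := by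
  have hc := hasCompactSupport_dilate hr hηc
  have h := hc.hasFDerivAt_convolution_right (ContinuousLinearMap.mul ℝ ℂ) hU
    ((contDiff_dilate r hη).of_le (by simp)) x
  have h2 : fderiv ℝ (mollify r η U) x = _ := h.fderiv
  rw [h2, convolution_precompR_apply _ hU (hc.fderiv ℝ)
    ((contDiff_dilate r hη).continuous_fderiv (by simp))]
  rfl

theorem enorm_dilate (hr : 0 < r) (z : E) :
    ‖dilate r η z‖ₑ = ENNReal.ofReal (r ^ Module.finrank ℝ E) * ‖η (r • z)‖ₑ := by
  rw [dilate, enorm_mul, ← Complex.ofReal_pow, ← ofReal_norm, Complex.norm_real,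
    Real.norm_of_nonneg (by positivity)]

theorem eLpNorm_mollify_le (hr : 0 < r) (hη : Continuous η) (hU : AEStronglyMeasurable U) :
    eLpNorm (mollify r η U) 2 ≤ (∫⁻ z, ‖η z‖ₑ) * eLpNorm U 2 := by
  rw [← lintegral_dilate hr (fun z => ‖η z‖ₑ) hη.enorm.measurable]
  have hm : Measurable fun z => ‖η z‖ₑ := hη.enorm.measurable
  refine eLpNorm_two_le_of_le_convolution hU
    ((hm.comp (measurable_const_smul r)).const_mul _) fun x => ?_
  rw [mollify_apply]
  refine (enorm_integral_le_lintegral_enorm _).trans (lintegral_mono fun y => ?_)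
  rw [enorm_mul, enorm_dilate hr]

theorem integrable_mul_comp_sub {g : E → ℂ} (hU : LocallyIntegrable U) (hg : Continuous g)
    (hgc : HasCompactSupport g) (x : E) : Integrable fun y => U y * g (x - y) :=
  hgc.convolutionExists_right (ContinuousLinearMap.mul ℝ ℂ) hU hg x

variable {d : ι → E} {a : ι → E → ℂ} {b : E → ℂ}

theorem exists_bound {f : E → ℂ} (hf : Continuous f) (hfc : HasCompactSupport f) :
    ∃ C : ℝ, 0 ≤ C ∧ ∀ x, ‖f x‖ ≤ C := by
  obtain ⟨C, hC⟩ := hfc.exists_bound_of_continuous hf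
  exact ⟨C, (norm_nonneg _).trans (hC 0), hC⟩

/-- Friedrichs' lemma: if `A U = V` weakly, the commutator error `A (U * η_r) - V * η_r` is bounded
in `L²` by a multiple of `‖U‖₂` that does not depend on `r`. It is an integral operator applied to
`U`, whose kernel contains the derivative of `η_r`, of size `r`, only multiplied by differences
`a j x - a j y`, of size `1 / r`. -/
theorem exists_eLpNorm_commutator_le (ha : ∀ j, ContDiff ℝ ∞ (a j))
    (hac : ∀ j, HasCompactSupport (a j)) (hb : ContDiff ℝ ∞ b) (hbc : HasCompactSupport b)
    (hη : ContDiff ℝ ∞ η) (hηc : HasCompactSupport η) :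
    ∃ C : ℝ≥0∞, C ≠ ⊤ ∧ ∀ U V : E → ℂ, LocallyIntegrable U →
      (∀ φ : E → ℂ, ContDiff ℝ ∞ φ → HasCompactSupport φ →
        ∫ y, U y * transposeOp d a b φ y = ∫ y, V y * φ y) →
      ∀ r : ℝ, 0 < r →
        eLpNorm (firstOrderOp d a b (mollify r η U) - mollify r η V) 2 ≤ C * eLpNorm U 2 := by
  choose L hL using fun j =>
    ContDiff.lipschitzWith_of_hasCompactSupport (hac j) (ha j) (by simp)
  obtain ⟨B, hB0, hB⟩ := exists_bound hb.continuous hbc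
  choose D hD0 hD using fun j => exists_bound
    (contDiff_fderiv_apply (ha j) (d j)).continuous (hasCompactSupport_fderiv_apply (hac j) (d j))
  set k : E → ℝ := fun z => (∑ j, (L j : ℝ) * ‖d j‖) * (‖z‖ * ‖fderiv ℝ η z‖)
    + (2 * B + ∑ j, D j) * ‖η z‖ with hk
  have hfc : Continuous (fderiv ℝ η) := hη.continuous_fderiv (by simp)
  have hηcont := hη.continuous
  have hkc : Continuous k := by fun_prop
  have hk0 : ∀ z, 0 ≤ k z := fun z => by
    have : 0 ≤ ∑ j, D j := Finset.sum_nonneg fun j _ => hD0 j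
    positivity
  have hksupp : HasCompactSupport k :=
    ((hηc.fderiv ℝ).norm.mul_left.mul_left).add hηc.norm.mul_left
  refine ⟨∫⁻ z, ENNReal.ofReal (k z), ?_, fun U V hU hUV r hr => ?_⟩
  · exact (hkc.integrable_of_hasCompactSupport hksupp).lintegral_lt_top.ne
  rw [← lintegral_dilate hr _ hkc.measurable.ennreal_ofReal]
  refine eLpNorm_two_le_of_le_convolution hU.aestronglyMeasurable (by fun_prop) fun x => ?_
  have hηr := contDiff_dilate r hη
  have hηrc := hasCompactSupport_dilate hr hηc
  set φ : E → ℂ := fun y => dilate r η (x - y) with hφ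
  have hφs : ContDiff ℝ ∞ φ := hηr.comp (contDiff_const.sub contDiff_id)
  have hφc : HasCompactSupport φ := hηrc.comp_homeomorph (Homeomorph.subLeft x)
  have hφ' : ∀ y v, fderiv ℝ φ y v = -fderiv ℝ (dilate r η) (x - y) v := by
    intro y v
    have h1 : HasFDerivAt (dilate r η) (fderiv ℝ (dilate r η) (x - y)) (x - y) :=
      (hηr.differentiable (by simp) _).hasFDerivAt
    have h2 : HasFDerivAt (fun y : E => x - y) (-ContinuousLinearMap.id ℝ E) y :=
      (hasFDerivAt_id y).const_sub x
    have h3 : fderiv ℝ φ y = _ := (h1.comp y h2).fderiv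
    rw [h3]
    simp
  have hI0 : Integrable fun y => U y * φ y :=
    integrable_mul_comp_sub hU hηr.continuous hηrc x
  have hI1 : ∀ j, Integrable fun y => U y * fderiv ℝ (dilate r η) (x - y) (d j) := fun j =>
    integrable_mul_comp_sub hU (contDiff_fderiv_apply hηr (d j)).continuous
      (hasCompactSupport_fderiv_apply hηrc (d j)) x
  have hI2 : Integrable fun y => U y * transposeOp d a b φ y := by
    simpa [mul_comm] using hU.integrable_smul_left_of_hasCompactSupport
      (contDiff_transposeOp (d := d) ha hb hφs).continuous (hasCompactSupport_transposeOp hφc)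
  set κ : E → ℂ := fun y => ∑ j, a j x * fderiv ℝ (dilate r η) (x - y) (d j) + b x * φ y
    - transposeOp d a b φ y with hκ
  have hF : (firstOrderOp d a b (mollify r η U) - mollify r η V) x = ∫ y, U y * κ y := by
    have hV : mollify r η V x = ∫ y, U y * transposeOp d a b φ y := (hUV φ hφs hφc).symm
    have hsum : Integrable fun y =>
        ∑ j, a j x * (U y * fderiv ℝ (dilate r η) (x - y) (d j)) :=
      integrable_finsetSum _ fun j _ => (hI1 j).const_mul _
    have h1 : ∫ y, U y * κ y = (∫ y, ∑ j, a j x * (U y * fderiv ℝ (dilate r η) (x - y) (d j)))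
        + (∫ y, b x * (U y * φ y)) - ∫ y, U y * transposeOp d a b φ y := by
      rw [← integral_add hsum (hI0.const_mul _),
        ← integral_sub (f := fun y => _ + _) (hsum.add (hI0.const_mul _)) hI2]
      congr with y
      simp only [hκ, mul_sub, mul_add, Finset.mul_sum]
      congr 2
      · exact Finset.sum_congr rfl fun j _ => by ring
      · ring
    rw [h1, integral_finsetSum _ fun j _ => (hI1 j).const_mul _, ← hV, Pi.sub_apply]
    simp only [integral_const_mul, firstOrderOp, fderiv_mollify hr hη hηc hU]
    rfl
  have hκle : ∀ y, ‖κ y‖ ≤ r ^ Module.finrank ℝ E * k (r • (x - y)) := by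
    intro y
    set R : ℝ := r ^ Module.finrank ℝ E with hR
    have hR0 : 0 ≤ R := by positivity
    set t := fderiv ℝ η (r • (x - y)) with ht
    have hfd : ∀ v, fderiv ℝ (dilate r η) (x - y) v = (R : ℂ) * (r * t v) := fun v => by
      rw [fderiv_dilate r hη, hR, Complex.ofReal_pow]
    have hφy : φ y = (R : ℂ) * η (r • (x - y)) := by
      rw [hφ, hR, Complex.ofReal_pow]; rfl
    have hκy : κ y = (R : ℂ) * (∑ j, (a j x - a j y) * (r * t (d j))
        + (b x - b y + ∑ j, fderiv ℝ (a j) y (d j)) * η (r • (x - y))) := by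
      simp only [hκ, transposeOp_apply ha hφs, hφ', hfd, hφy, sub_mul, Finset.sum_sub_distrib,
        mul_add, Finset.mul_sum, mul_sub, mul_neg, neg_neg, add_mul, Finset.sum_mul]
      have e1 : ∀ w : E, ∑ j, (R : ℂ) * (a j w * (r * t (d j)))
          = ∑ j, a j w * ((R : ℂ) * (r * t (d j))) :=
        fun w => Finset.sum_congr rfl fun j _ => by ring
      have e2 : ∑ j, (R : ℂ) * (fderiv ℝ (a j) y (d j) * η (r • (x - y)))
          = ∑ j, fderiv ℝ (a j) y (d j) * ((R : ℂ) * η (r • (x - y))) :=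
        Finset.sum_congr rfl fun j _ => by ring
      rw [e1, e1, e2]
      ring
    rw [hκy, norm_mul, Complex.norm_real, Real.norm_of_nonneg hR0]
    refine mul_le_mul_of_nonneg_left ((norm_add_le _ _).trans (add_le_add ?_ ?_)) hR0
    · rw [Finset.sum_mul]
      refine (norm_sum_le _ _).trans (Finset.sum_le_sum fun j _ => ?_)
      have h1 : ‖a j x - a j y‖ ≤ L j * ‖x - y‖ := by
        simpa [dist_eq_norm] using (hL j).dist_le_mul x y
      calc ‖(a j x - a j y) * (r * t (d j))‖ = ‖a j x - a j y‖ * (r * ‖t (d j)‖) := by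
            rw [norm_mul, norm_mul, Complex.norm_real, Real.norm_of_nonneg hr.le]
        _ ≤ (L j * ‖x - y‖) * (r * (‖t‖ * ‖d j‖)) := by
            gcongr
            exact t.le_opNorm _
        _ = L j * ‖d j‖ * (‖r • (x - y)‖ * ‖t‖) := by
            rw [norm_smul, Real.norm_of_nonneg hr.le]
            ring
    · rw [norm_mul]
      refine mul_le_mul_of_nonneg_right ((norm_add_le _ _).trans (add_le_add ?_ ?_))
        (norm_nonneg _)
      · linarith [norm_sub_le (b x) (b y), hB x, hB y]
      · exact (norm_sum_le _ _).trans (Finset.sum_le_sum fun j _ => hD j y)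
  rw [hF]
  refine (enorm_integral_le_lintegral_enorm _).trans (lintegral_mono fun y => ?_)
  rw [enorm_mul, ← ENNReal.ofReal_mul (by positivity)]
  gcongr
  rw [← ofReal_norm]
  exact ENNReal.ofReal_le_ofReal (hκle y)

/-- Mollifications converge weakly. -/
theorem tendsto_integral_mollify_mul (hη : ContDiff ℝ ∞ η) (hηc : HasCompactSupport η)
    (hη1 : ∫ z, η z = 1) (hU : Integrable U) {ψ : E → ℂ} (hψ : Continuous ψ)
    (hψc : HasCompactSupport ψ) :
    Tendsto (fun N : ℕ => ∫ x, mollify (N + 1) η U x * ψ x) atTop (𝓝 (∫ x, U x * ψ x)) := by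
  obtain ⟨C, hC0, hC⟩ := exists_bound hψ hψc
  have hηI : Integrable η := hη.continuous.integrable_of_hasCompactSupport hηc
  have hr : ∀ N : ℕ, (0 : ℝ) < N + 1 := fun N => by positivity
  -- transposing the convolution, the integral becomes `∫ U ψ_N`
  have hswap : ∀ N : ℕ, ∫ x, mollify (N + 1) η U x * ψ x
      = ∫ y, U y * ∫ z, η z * ψ (y + ((N : ℝ) + 1)⁻¹ • z) := by
    intro N
    have hc := hasCompactSupport_dilate (hr N) hηc
    have hcont := (contDiff_dilate ((N : ℝ) + 1) hη).continuous
    have hint : Integrable (Function.uncurry fun x y => U y * dilate (N + 1) η (x - y) * ψ x)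
        ((volume : Measure E).prod volume) :=
      (hU.convolution_integrand (ContinuousLinearMap.mul ℝ ℂ)
        (hcont.integrable_of_hasCompactSupport hc)).mul_bdd (c := C)
        (hψ.comp continuous_fst).aestronglyMeasurable (ae_of_all _ fun p => hC p.1)
    calc ∫ x, mollify (N + 1) η U x * ψ x
        = ∫ x, ∫ y, U y * dilate (N + 1) η (x - y) * ψ x := by
          congr with x
          rw [mollify_apply, integral_mul_const]
      _ = ∫ y, ∫ x, U y * dilate (N + 1) η (x - y) * ψ x := integral_integral_swap hint
      _ = ∫ y, U y * ∫ z, η z * ψ (y + ((N : ℝ) + 1)⁻¹ • z) := by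
          congr with y
          rw [← integral_dilate_mul (hr N) η fun z => ψ (y + z), ← integral_const_mul,
            ← integral_sub_right_eq_self (fun z => U y * (dilate (N + 1) η z * ψ (y + z))) y]
          congr with x
          rw [add_sub_cancel, mul_assoc]
  simp only [hswap]
  have hbd : ∀ (N : ℕ) (y : E), ‖∫ z, η z * ψ (y + ((N : ℝ) + 1)⁻¹ • z)‖ ≤ (∫ z, ‖η z‖) * C := by
    intro N y
    rw [← integral_mul_const]
    refine norm_integral_le_of_norm_le (hηI.norm.mul_const C) (ae_of_all _ fun z => ?_)
    rw [norm_mul]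
    gcongr
    exact hC _
  have hmeas : ∀ N : ℕ, AEStronglyMeasurable
      (fun y => ∫ z, η z * ψ (y + ((N : ℝ) + 1)⁻¹ • z)) (volume : Measure E) := by
    intro N
    have hcη := hη.continuous
    have : Continuous (Function.uncurry fun y z => η z * ψ (y + ((N : ℝ) + 1)⁻¹ • z)) := by
      fun_prop
    exact (this.stronglyMeasurable.integral_prod_right (ν := volume)).aestronglyMeasurable
  refine tendsto_integral_of_dominated_convergence (fun y => ‖U y‖ * ((∫ z, ‖η z‖) * C))
    (fun N => hU.aestronglyMeasurable.mul (hmeas N)) (hU.norm.mul_const _)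
    (fun N => ae_of_all _ fun y => ?_) (ae_of_all _ fun y => ?_)
  · rw [norm_mul]
    gcongr
    exact hbd N y
  · refine Tendsto.const_mul _ ?_
    have hlim : ∫ z, η z * ψ y = ψ y := by rw [integral_mul_const, hη1, one_mul]
    rw [← hlim]
    refine tendsto_integral_of_dominated_convergence (fun z => ‖η z‖ * C)
      (fun N => ?_) (hηI.norm.mul_const _) (fun N => ae_of_all _ fun z => ?_)
      (ae_of_all _ fun z => ?_)
    · have hcη := hη.continuous
      have : Continuous fun z => η z * ψ (y + ((N : ℝ) + 1)⁻¹ • z) := by fun_prop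
      exact this.aestronglyMeasurable
    · rw [norm_mul]
      gcongr
      exact hC _
    · refine Tendsto.const_mul _ ?_
      have h0 : Tendsto (fun N : ℕ => ((N : ℝ) + 1)⁻¹) atTop (𝓝 0) := by
        simpa using tendsto_one_div_add_atTop_nhds_zero_nat (𝕜 := ℝ)
      have h1 : Tendsto (fun N : ℕ => y + ((N : ℝ) + 1)⁻¹ • z) atTop (𝓝 y) := by
        simpa using (h0.smul_const z).const_add y
      exact (hψ.tendsto y).comp h1

end Mollify

section Approximation

variable {E ι : Type*} [NormedAddCommGroup E] [NormedSpace ℝ E] [Fintype ι]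
  [FiniteDimensional ℝ E] [MeasureSpace E] [BorelSpace E] [(volume : Measure E).IsAddHaarMeasure]

theorem exists_tsupport_mollify_subset {η U : E → ℂ} (hηc : HasCompactSupport η) {K O : Set E}
    (hK : IsCompact K) (hO : IsOpen O) (hKO : K ⊆ O) (hUK : ∀ x ∉ K, U x = 0) :
    ∃ N₀ : ℕ, ∀ N ≥ N₀, HasCompactSupport (mollify (N + 1) η U) ∧
      tsupport (mollify (N + 1) η U) ⊆ O := by
  obtain ⟨δ, hδ, hδO⟩ := hK.exists_cthickening_subset_open hO hKO
  obtain ⟨R, hR0, hR⟩ := hηc.isBounded.exists_pos_norm_le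
  obtain ⟨N₀, hN₀⟩ := exists_nat_gt (R / δ)
  refine ⟨N₀, fun N hN => ?_⟩
  have hr : (0 : ℝ) < N + 1 := by positivity
  have hRr : R / (N + 1) ≤ δ := by
    rw [div_le_iff₀ hr]
    rw [div_lt_iff₀ hδ] at hN₀
    have : (N₀ : ℝ) ≤ N := by exact_mod_cast hN
    nlinarith
  have hzero : ∀ x ∉ Metric.cthickening δ K, mollify (N + 1) η U x = 0 := by
    intro x hx
    rw [mollify_apply]
    refine integral_eq_zero_of_ae (ae_of_all _ fun y => ?_)
    by_cases hy : y ∈ K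
    · have : ((N : ℝ) + 1) • (x - y) ∉ tsupport η := by
        intro hmem
        have h1 := hR _ hmem
        rw [norm_smul, Real.norm_of_nonneg hr.le, ← dist_eq_norm] at h1
        refine hx (Metric.mem_cthickening_of_dist_le x y δ K hy (le_trans ?_ hRr))
        rw [le_div_iff₀ hr]
        linarith
      simp [dilate, image_eq_zero_of_notMem_tsupport this]
    · simp [hUK y hy]
  exact ⟨HasCompactSupport.intro hK.cthickening hzero,
    (closure_minimal (Function.support_subset_iff'.2 hzero)
      Metric.isClosed_cthickening).trans hδO⟩

/-- The graph in `L² × L²` of a first-order operator with domain the test functions on `O`. -/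
noncomputable def testGraph (d : ι → E) (a : ι → E → ℂ) (b : E → ℂ) (O : Set E) :
    Submodule ℂ (Lp ℂ 2 (volume : Measure E) × Lp ℂ 2 (volume : Measure E)) where
  carrier := {q | ∃ W : E → ℂ, ContDiff ℝ ∞ W ∧ HasCompactSupport W ∧ tsupport W ⊆ O ∧
    q.1 =ᵐ[volume] W ∧ q.2 =ᵐ[volume] firstOrderOp d a b W}
  add_mem' := by
    rintro p q ⟨W, hW, hWc, hWO, h1, h2⟩ ⟨W', hW', hWc', hWO', h1', h2'⟩
    refine ⟨W + W', hW.add hW', hWc.add hWc', (tsupport_add W W').trans (union_subset hWO hWO'),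
      (Lp.coeFn_add _ _).trans (h1.add h1'), ?_⟩
    rw [firstOrderOp_add hW hW']
    exact (Lp.coeFn_add _ _).trans (h2.add h2')
  zero_mem' := by
    refine ⟨0, contDiff_const, HasCompactSupport.zero, by simp [tsupport], Lp.coeFn_zero _ _ _, ?_⟩
    have : firstOrderOp d a b 0 = 0 := by
      ext y
      simp [firstOrderOp]
    rw [this]
    exact Lp.coeFn_zero _ _ _
  smul_mem' := by
    rintro c p ⟨W, hW, hWc, hWO, h1, h2⟩
    refine ⟨c • W, contDiff_const.smul hW, hWc.smul_left (f := fun _ => c),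
      (tsupport_smul_subset_right (fun _ => c) W).trans hWO,
      (Lp.coeFn_smul _ _).trans (h1.const_smul c), ?_⟩
    rw [firstOrderOp_smul c hW]
    exact (Lp.coeFn_smul _ _).trans (h2.const_smul c)

theorem norm_toLp_le {α : Type*} [MeasurableSpace α] {μ : Measure α} {f : α → ℂ}
    (hf : MemLp f 2 μ) {C : ℝ≥0∞} (hC : C ≠ ⊤) (h : eLpNorm f 2 μ ≤ C) :
    ‖hf.toLp f‖ ≤ C.toReal := by
  rw [Lp.norm_toLp]
  exact ENNReal.toReal_mono hC h

theorem inner_toLp_eq {α : Type*} [MeasurableSpace α] {μ : Measure α} {f g : α → ℂ}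
    (hf : MemLp f 2 μ) {y : Lp ℂ 2 μ} (hy : y =ᵐ[μ] g) :
    ⟪y, hf.toLp f⟫_ℂ = ∫ x, f x * (starRingEnd ℂ) (g x) ∂μ := by
  rw [L2.inner_def]
  refine integral_congr_ae ?_
  filter_upwards [hf.coeFn_toLp, hy] with x h1 h2
  rw [h1, h2]
  exact RCLike.inner_apply _ _

/-- If `A U = V` weakly and `U` is supported in a compact subset of `O`, then `(U, V)` is in the
`L²`-closure of the graph of `A` on test functions supported in `O`. The mollifications of `U`
provide a bounded sequence in the graph that converges weakly to `(U, V)`. -/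
theorem exists_testFunction_approx {d : ι → E} {a : ι → E → ℂ} {b : E → ℂ}
    (ha : ∀ j, ContDiff ℝ ∞ (a j)) (hac : ∀ j, HasCompactSupport (a j)) (hb : ContDiff ℝ ∞ b)
    (hbc : HasCompactSupport b) {U V : E → ℂ} (hU : MemLp U 2) (hV : MemLp V 2) {K O : Set E}
    (hK : IsCompact K) (hO : IsOpen O) (hKO : K ⊆ O) (hUK : ∀ x ∉ K, U x = 0)
    (hUV : ∀ φ : E → ℂ, ContDiff ℝ ∞ φ → HasCompactSupport φ →
      ∫ y, U y * transposeOp d a b φ y = ∫ y, V y * φ y) {δ : ℝ} (hδ : 0 < δ) :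
    ∃ W : E → ℂ, ContDiff ℝ ∞ W ∧ HasCompactSupport W ∧ tsupport W ⊆ O ∧
      eLpNorm (W - U) 2 ≤ ENNReal.ofReal δ ∧
      eLpNorm (firstOrderOp d a b W - V) 2 ≤ ENNReal.ofReal δ := by
  obtain ⟨η, hη, hηc, hη1⟩ := exists_mollifier (E := E)
  obtain ⟨N₀, hN₀⟩ := exists_tsupport_mollify_subset hηc hK hO hKO hUK
  obtain ⟨C, hC, hcomm⟩ := exists_eLpNorm_commutator_le (d := d) ha hac hb hbc hη hηc
  have hUloc : LocallyIntegrable U := hU.locallyIntegrable (by norm_num)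
  have hUint : Integrable U :=
    (integrableOn_iff_integrable_of_support_subset (Function.support_subset_iff'.2 hUK)).1
      (hUloc.integrableOn_isCompact hK)
  have hr : ∀ N : ℕ, (0 : ℝ) < N + 1 := fun N => by positivity
  set W : ℕ → E → ℂ := fun N => mollify (N + 1) η U with hW
  have hWs : ∀ N, ContDiff ℝ ∞ (W N) := fun N => contDiff_mollify (hr N) hη hηc hUloc
  have hAWs : ∀ N, ContDiff ℝ ∞ (firstOrderOp d a b (W N)) := fun N =>
    contDiff_firstOrderOp ha hb (hWs N)
  have hηfin : ∫⁻ z, ‖η z‖ₑ ≠ ⊤ := (hη.continuous.integrable_of_hasCompactSupport hηc).2.ne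
  set C₁ := (∫⁻ z, ‖η z‖ₑ) * eLpNorm U 2 with hC₁
  set C₂ := C * eLpNorm U 2 + (∫⁻ z, ‖η z‖ₑ) * eLpNorm V 2 with hC₂
  have hC₁fin : C₁ ≠ ⊤ := ENNReal.mul_ne_top hηfin hU.2.ne
  have hC₂fin : C₂ ≠ ⊤ := ENNReal.add_ne_top.2
    ⟨ENNReal.mul_ne_top hC hU.2.ne, ENNReal.mul_ne_top hηfin hV.2.ne⟩
  have hb₁ : ∀ N, eLpNorm (W N) 2 ≤ C₁ := fun N =>
    eLpNorm_mollify_le (hr N) hη.continuous hU.1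
  have hb₂ : ∀ N, eLpNorm (firstOrderOp d a b (W N)) 2 ≤ C₂ := by
    intro N
    have hVs := (contDiff_mollify (hr N) hη hηc
      (hV.locallyIntegrable (by norm_num))).continuous.aestronglyMeasurable (μ := volume)
    have h1 := eLpNorm_add_le ((hAWs N).continuous.aestronglyMeasurable.sub hVs) hVs
      (p := 2) (by norm_num)
    rw [sub_add_cancel] at h1
    exact h1.trans (add_le_add (hcomm U V hUloc hUV _ (hr N))
      (eLpNorm_mollify_le (hr N) hη.continuous hV.1))
  have hm₁ : ∀ N, MemLp (W N) 2 := fun N =>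
    ⟨(hWs N).continuous.aestronglyMeasurable, (hb₁ N).trans_lt hC₁fin.lt_top⟩
  have hm₂ : ∀ N, MemLp (firstOrderOp d a b (W N)) 2 := fun N =>
    ⟨(hAWs N).continuous.aestronglyMeasurable, (hb₂ N).trans_lt hC₂fin.lt_top⟩
  have hlim : ∀ ψ : E → ℂ, Continuous ψ → HasCompactSupport ψ →
      Tendsto (fun N => ∫ x, W N x * ψ x) atTop (𝓝 (∫ x, U x * ψ x)) :=
    fun ψ h h' => tendsto_integral_mollify_mul hη hηc hη1 hUint h h'
  have hmem : (hU.toLp U, hV.toLp V) ∈ (testGraph d a b O).topologicalClosure := by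
    -- the index is shifted by `N₀`, after which the mollifications are supported in `O`
    refine mem_closure_of_tendsto_inner _
      (x := fun N => ((hm₁ (N + N₀)).toLp _, (hm₂ (N + N₀)).toLp _))
      (C := max C₁.toReal C₂.toReal) (fun N => ?_) (fun N => ?_)
      (Lp.dense_hasCompactSupport_contDiff (by norm_num)) ?_ ?_
    · exact ⟨W (N + N₀), hWs _, (hN₀ _ (by lia)).1, (hN₀ _ (by lia)).2,
        (hm₁ _).coeFn_toLp, (hm₂ _).coeFn_toLp⟩
    · exact max_le_max (norm_toLp_le (hm₁ _) hC₁fin (hb₁ _)) (norm_toLp_le (hm₂ _) hC₂fin (hb₂ _))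
    · rintro y ⟨g, hyg, hgc, hg⟩
      simp only [inner_toLp_eq _ hyg]
      exact (tendsto_add_atTop_iff_nat N₀).2 (hlim (fun x => (starRingEnd ℂ) (g x))
        (Complex.continuous_conj.comp hg.continuous)
        (hgc.comp_left (g := starRingEnd ℂ) (map_zero _)))
    · rintro y ⟨g, hyg, hgc, hg⟩
      simp only [inner_toLp_eq _ hyg]
      have hgs : ContDiff ℝ ∞ fun x => (starRingEnd ℂ) (g x) :=
        Complex.conjCLE.contDiff.comp hg
      have hgc' : HasCompactSupport fun x => (starRingEnd ℂ) (g x) :=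
        hgc.comp_left (g := starRingEnd ℂ) (map_zero _)
      rw [← hUV _ hgs hgc']
      simp only [fun N => integral_firstOrderOp_mul (d := d) ha hb (hWs N) hgs hgc']
      exact (tendsto_add_atTop_iff_nat N₀).2 (hlim _
        (contDiff_transposeOp ha hb hgs).continuous (hasCompactSupport_transposeOp hgc'))
  obtain ⟨q, ⟨w, hw, hwc, hwO, hq₁, hq₂⟩, hdist⟩ := Metric.mem_closure_iff.1 hmem δ hδ
  rw [Prod.dist_eq, max_lt_iff] at hdist
  have key : ∀ {f g : E → ℂ} (hf : MemLp f 2) {s : Lp ℂ 2 (volume : Measure E)},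
      s =ᵐ[volume] g → dist (hf.toLp f) s < δ → eLpNorm (g - f) 2 ≤ ENNReal.ofReal δ := by
    intro f g hf s hs h
    rw [Lp.dist_def] at h
    have h2 : eLpNorm (g - f) 2 = eLpNorm (hf.toLp f - s : E → ℂ) 2 := by
      rw [eLpNorm_sub_comm]
      exact eLpNorm_congr_ae (hf.coeFn_toLp.symm.sub hs.symm)
    rw [h2]
    exact (ENNReal.le_ofReal_iff_toReal_le
      ((Lp.memLp (hf.toLp f)).sub (Lp.memLp s)).eLpNorm_ne_top hδ.le).2 h.le
  exact ⟨w, hw, hwc, hwO, key hU hq₁ hdist.1, key hV hq₂ hdist.2⟩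

end Approximation

/-! ### Measures and functions in a chart -/

section Chart

variable {n : ℕ} {M : Type*} [TopologicalSpace M] [ChartedSpace (EuclideanSpace ℝ (Fin n)) M]

section Measure

variable [MeasurableSpace M] [BorelSpace M]

/-- In the chart `e`, the measure `μ` has the smooth positive density `ρ`. -/
structure IsChartDensity (μ : Measure M) (e : OpenPartialHomeomorph M (EuclideanSpace ℝ (Fin n)))
    (ρ : EuclideanSpace ℝ (Fin n) → ℝ) : Prop where
  contDiffOn : ContDiffOn ℝ ∞ ρ e.target
  pos : ∀ y ∈ e.target, 0 < ρ y
  map_eq : (μ.restrict e.source).map e =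
    (volume.restrict e.target).withDensity (fun y => ENNReal.ofReal (ρ y))

variable {μ : Measure M} {e : OpenPartialHomeomorph M (EuclideanSpace ℝ (Fin n))}
  {ρ : EuclideanSpace ℝ (Fin n) → ℝ}

theorem aemeasurable_symm (e : OpenPartialHomeomorph M (EuclideanSpace ℝ (Fin n)))
    (ρ : EuclideanSpace ℝ (Fin n) → ℝ) :
    AEMeasurable e.symm
      ((volume.restrict e.target).withDensity fun y => ENNReal.ofReal (ρ y)) :=
  (e.continuousOn_symm.aemeasurable e.open_target.measurableSet).mono_ac
    (withDensity_absolutelyContinuous _ _)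

theorem IsChartDensity.map_symm (h : IsChartDensity μ e ρ) :
    ((volume.restrict e.target).withDensity fun y => ENNReal.ofReal (ρ y)).map e.symm
      = μ.restrict e.source := by
  have he : AEMeasurable e (μ.restrict e.source) :=
    e.continuousOn.aemeasurable e.open_source.measurableSet
  have hs := aemeasurable_symm e ρ
  rw [← h.map_eq] at hs ⊢
  rw [AEMeasurable.map_map_of_aemeasurable hs he]
  have : e.symm ∘ e =ᵐ[μ.restrict e.source] id := by
    filter_upwards [ae_restrict_mem e.open_source.measurableSet] with x hx
    exact e.left_inv hx
  rw [Measure.map_congr this, Measure.map_id]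

theorem IsChartDensity.aemeasurable (h : IsChartDensity μ e ρ) :
    AEMeasurable (fun y => ENNReal.ofReal (ρ y)) (volume.restrict e.target) :=
  (h.contDiffOn.continuousOn.aemeasurable e.open_target.measurableSet).ennreal_ofReal

/-- Integrals of functions that vanish off a chart, in coordinates. -/
theorem IsChartDensity.integral_eq (h : IsChartDensity μ e ρ) {F : M → ℂ}
    (hF : AEStronglyMeasurable F μ) (hF0 : ∀ x ∉ e.source, F x = 0) :
    ∫ x, F x ∂μ = ∫ y in e.target, ρ y * F (e.symm y) := by
  rw [← setIntegral_eq_integral_of_forall_compl_eq_zero hF0, ← h.map_symm,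
    integral_map (aemeasurable_symm e ρ) (by rw [h.map_symm]; exact hF.restrict),
    integral_withDensity_eq_integral_toReal_smul₀ h.aemeasurable
      (ae_of_all _ fun _ => ENNReal.ofReal_lt_top)]
  refine setIntegral_congr_fun e.open_target.measurableSet fun y hy => ?_
  rw [ENNReal.toReal_ofReal (h.pos y hy).le, Complex.real_smul]

theorem IsChartDensity.restrict_eq {K : Set (EuclideanSpace ℝ (Fin n))} (hK : MeasurableSet K)
    (hKe : K ⊆ e.target) :
    ((volume.restrict e.target).withDensity fun y => ENNReal.ofReal (ρ y)).restrict K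
      = (volume.restrict K).withDensity fun y => ENNReal.ofReal (ρ y) := by
  rw [restrict_withDensity hK, Measure.restrict_restrict hK, inter_eq_left.2 hKe]

/-- On a compact subset of the range of a chart, Lebesgue measure is dominated by the density. -/
theorem IsChartDensity.exists_volume_le (h : IsChartDensity μ e ρ)
    {K : Set (EuclideanSpace ℝ (Fin n))} (hK : IsCompact K) (hKe : K ⊆ e.target) :
    ∃ c : ℝ≥0∞, c ≠ ⊤ ∧ volume.restrict K ≤
      c • ((volume.restrict e.target).withDensity fun y => ENNReal.ofReal (ρ y)) := by
  have hcont : ContinuousOn (fun y => (ρ y)⁻¹) K :=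
    (h.contDiffOn.continuousOn.mono hKe).inv₀ fun y hy => (h.pos y (hKe hy)).ne'
  obtain ⟨C, hC⟩ := hK.exists_bound_of_continuousOn hcont
  refine ⟨ENNReal.ofReal C, ENNReal.ofReal_ne_top, ?_⟩
  have h0 : ENNReal.ofReal C • ((volume.restrict e.target).withDensity
      fun y => ENNReal.ofReal (ρ y)).restrict K ≤ ENNReal.ofReal C •
        ((volume.restrict e.target).withDensity fun y => ENNReal.ofReal (ρ y)) :=
    Measure.le_iff'.2 fun s => mul_le_mul' le_rfl (Measure.restrict_le_self s)
  refine le_trans ?_ h0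
  rw [IsChartDensity.restrict_eq hK.measurableSet hKe,
    ← withDensity_smul' _ _ ENNReal.ofReal_ne_top]
  nth_rewrite 1 [← withDensity_one (μ := volume.restrict K)]
  refine withDensity_mono ?_
  filter_upwards [ae_restrict_mem hK.measurableSet] with y hy
  have hy0 := h.pos y (hKe hy)
  have h1 : (ρ y)⁻¹ ≤ C := (le_abs_self _).trans (hC y hy)
  simp only [Pi.one_apply, Pi.smul_apply, smul_eq_mul]
  rw [← ENNReal.ofReal_mul ((inv_pos.2 hy0).le.trans h1), ← ENNReal.ofReal_one]
  refine ENNReal.ofReal_le_ofReal ?_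
  rwa [inv_le_iff_one_le_mul₀ hy0] at h1

/-- On a compact subset of the range of a chart, the density is dominated by Lebesgue measure. -/
theorem IsChartDensity.exists_le_volume (h : IsChartDensity μ e ρ)
    {K : Set (EuclideanSpace ℝ (Fin n))} (hK : IsCompact K) (hKe : K ⊆ e.target) :
    ∃ c : ℝ≥0∞, c ≠ ⊤ ∧
      ((volume.restrict e.target).withDensity fun y => ENNReal.ofReal (ρ y)).restrict K
        ≤ c • volume.restrict K := by
  obtain ⟨C, hC⟩ := hK.exists_bound_of_continuousOn (h.contDiffOn.continuousOn.mono hKe)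
  refine ⟨ENNReal.ofReal C, ENNReal.ofReal_ne_top, ?_⟩
  rw [IsChartDensity.restrict_eq hK.measurableSet hKe, ← withDensity_const]
  refine withDensity_mono ?_
  filter_upwards [ae_restrict_mem hK.measurableSet] with y hy
  exact ENNReal.ofReal_le_ofReal ((le_abs_self _).trans (hC y hy))

theorem IsChartDensity.memLp_comp_symm (h : IsChartDensity μ e ρ) {F : M → ℂ} (hF : MemLp F 2 μ)
    {K : Set (EuclideanSpace ℝ (Fin n))} (hK : IsCompact K) (hKe : K ⊆ e.target) :
    MemLp (K.indicator (F ∘ e.symm)) 2 := by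
  obtain ⟨c, hc, hle⟩ := h.exists_volume_le hK hKe
  rw [memLp_indicator_iff_restrict hK.measurableSet]
  refine MemLp.of_measure_le_smul hc hle ?_
  have hF' := hF.restrict e.source
  rw [← h.map_symm] at hF'
  exact hF'.comp_of_map (aemeasurable_symm e ρ)

/-- The `L²(μ)` norm of a function carried by a compact part of a chart is bounded by its `L²` norm
in coordinates. -/
theorem IsChartDensity.exists_eLpNorm_le (h : IsChartDensity μ e ρ)
    {K : Set (EuclideanSpace ℝ (Fin n))} (hK : IsCompact K) (hKe : K ⊆ e.target) :
    ∃ C : ℝ≥0∞, C ≠ ⊤ ∧ ∀ F : M → ℂ, AEStronglyMeasurable F μ →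
      (∀ x, ¬(x ∈ e.source ∧ e x ∈ K) → F x = 0) →
      eLpNorm F 2 μ ≤ C * eLpNorm (K.indicator (F ∘ e.symm)) 2 := by
  obtain ⟨c, hc, hle⟩ := h.exists_le_volume hK hKe
  refine ⟨c ^ (1 / (2 : ℝ≥0∞)).toReal, ENNReal.rpow_ne_top_of_nonneg (by simp) hc,
    fun F hF hF0 => ?_⟩
  have hsupp : F.support ⊆ e.source := Function.support_subset_iff'.2
    fun x hx => hF0 x fun h => hx h.1
  have hsupp2 : ∀ᵐ y ∂((volume.restrict e.target).withDensity fun y => ENNReal.ofReal (ρ y)),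
      (F ∘ e.symm) y = K.indicator (F ∘ e.symm) y := by
    have : ∀ᵐ y ∂((volume.restrict e.target).withDensity fun y => ENNReal.ofReal (ρ y)),
      y ∈ e.target := (withDensity_absolutelyContinuous _ _).ae_le
        (ae_restrict_mem e.open_target.measurableSet)
    filter_upwards [this] with y hy
    by_cases hyK : y ∈ K
    · rw [indicator_of_mem hyK]
    · rw [indicator_of_notMem hyK]
      refine hF0 _ fun h' => hyK ?_
      rw [← e.right_inv hy]
      exact h'.2
  rw [← eLpNorm_restrict_eq_of_support_subset (μ := μ) (p := 2) hsupp, ← h.map_symm,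
    eLpNorm_map_measure (by rw [h.map_symm]; exact hF.restrict) (aemeasurable_symm e ρ),
    eLpNorm_congr_ae hsupp2, eLpNorm_indicator_eq_eLpNorm_restrict hK.measurableSet,
    eLpNorm_indicator_eq_eLpNorm_restrict hK.measurableSet]
  exact eLpNorm_le_of_measure_le_smul hle

end Measure

section Pullback

variable [T2Space M] [IsManifold (𝓡 n) ∞ M]
  {e : OpenPartialHomeomorph M (EuclideanSpace ℝ (Fin n))}
  {φ : EuclideanSpace ℝ (Fin n) → ℂ}

theorem contDiffOn_comp_symm (he : e ∈ IsManifold.maximalAtlas (𝓡 n) ∞ M) (f : Smooth n M) :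
    ContDiffOn ℝ ∞ (fun y => f.1 (e.symm y)) e.target := by
  rw [← contMDiffOn_iff_contDiffOn]
  exact (ContMDiff.contMDiffOn (s := univ) f.2).comp (contMDiffOn_symm_of_mem_maximalAtlas he)
    fun _ _ => mem_univ _

theorem isClosed_symm_image (e : OpenPartialHomeomorph M (EuclideanSpace ℝ (Fin n)))
    {K : Set (EuclideanSpace ℝ (Fin n))} (hK : IsCompact K) (hKe : K ⊆ e.target) :
    IsClosed (e.symm '' K) :=
  (hK.image_of_continuousOn (e.continuousOn_symm.mono hKe)).isClosed

theorem tsupport_pullback_subset (hc : HasCompactSupport φ) (hφe : tsupport φ ⊆ e.target) :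
    tsupport (e.source.indicator (φ ∘ e)) ⊆ e.symm '' tsupport φ := by
  refine closure_minimal ?_ (isClosed_symm_image e hc hφe)
  intro x hx
  have hxs : x ∈ e.source := by
    by_contra h
    exact hx (indicator_of_notMem h _)
  rw [Function.mem_support, indicator_of_mem hxs] at hx
  exact ⟨e x, subset_tsupport _ hx, e.left_inv hxs⟩

/-- A test function supported in the range of a chart, viewed as a smooth function on the manifold
that vanishes off the chart. -/
noncomputable def pullback (he : e ∈ IsManifold.maximalAtlas (𝓡 n) ∞ M) (hφ : ContDiff ℝ ∞ φ)
    (hc : HasCompactSupport φ) (hφe : tsupport φ ⊆ e.target) : Smooth n M :=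
  ⟨e.source.indicator (φ ∘ e), by
    refine contMDiff_of_tsupport fun x hx => ?_
    have hxs : x ∈ e.source := by
      obtain ⟨y, hy, rfl⟩ := tsupport_pullback_subset hc hφe hx
      exact e.map_target (hφe hy)
    have h1 : ContMDiffAt (𝓡 n) 𝓘(ℝ, ℂ) ∞ (φ ∘ e) x :=
      hφ.contMDiff.contMDiffAt.comp x (contMDiffAt_of_mem_maximalAtlas he hxs)
    refine h1.congr_of_eventuallyEq ?_
    filter_upwards [e.open_source.mem_nhds hxs] with z hz
    exact indicator_of_mem hz _⟩

theorem pullback_symm_apply (he : e ∈ IsManifold.maximalAtlas (𝓡 n) ∞ M) (hφ : ContDiff ℝ ∞ φ)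
    (hc : HasCompactSupport φ) (hφe : tsupport φ ⊆ e.target) {y : EuclideanSpace ℝ (Fin n)}
    (hy : y ∈ e.target) : (pullback he hφ hc hφe).1 (e.symm y) = φ y := by
  change e.source.indicator (φ ∘ e) (e.symm y) = φ y
  rw [indicator_of_mem (e.map_target hy), Function.comp_apply, e.right_inv hy]

variable {P : Smooth n M →ₗ[ℂ] Smooth n M}

/-- Differential operators do not enlarge supports. -/
theorem IsDiffOpDegreeOne.apply_eq_zero (hP : IsDiffOpDegreeOne P) (f : Smooth n M) {x : M}
    (hx : x ∉ tsupport f.1) : (P f).1 x = 0 := by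
  let c := chartAt (EuclideanSpace ℝ (Fin n)) x
  obtain ⟨a, b, h⟩ := hP c (IsManifold.chart_mem_maximalAtlas x)
  have hxc : x ∈ c.source := mem_chart_source _ x
  have hev : (fun z => f.1 (c.symm z)) =ᶠ[𝓝 (c x)] fun _ => 0 := by
    have h1 : f.1 =ᶠ[𝓝 (c.symm (c x))] 0 := by
      rw [c.left_inv hxc]
      exact notMem_tsupport_iff_eventuallyEq.1 hx
    exact (c.continuousAt_symm (c.map_source hxc)).eventually h1
  have h2 := h.apply_eq f (c x) (c.map_source hxc)
  rw [hev.fderiv_eq, hev.eq_of_nhds, c.left_inv hxc] at h2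
  simpa using h2

/-- The directions of the partial derivatives. -/
noncomputable abbrev stdDir (n : ℕ) (j : Fin n) : EuclideanSpace ℝ (Fin n) :=
  EuclideanSpace.single j 1

theorem IsLocalForm.pullback_apply {a : Fin n → EuclideanSpace ℝ (Fin n) → ℂ}
    {b : EuclideanSpace ℝ (Fin n) → ℂ} (h : IsLocalForm P e a b)
    (he : e ∈ IsManifold.maximalAtlas (𝓡 n) ∞ M) (hφ : ContDiff ℝ ∞ φ)
    (hc : HasCompactSupport φ) (hφe : tsupport φ ⊆ e.target) {y : EuclideanSpace ℝ (Fin n)}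
    (hy : y ∈ e.target) :
    (P (pullback he hφ hc hφe)).1 (e.symm y) = firstOrderOp (stdDir n) a b φ y := by
  have hev : (fun z => (pullback he hφ hc hφe).1 (e.symm z)) =ᶠ[𝓝 y] φ := by
    filter_upwards [e.open_target.mem_nhds hy] with z hz
    exact pullback_symm_apply he hφ hc hφe hz
  rw [h.apply_eq _ y hy, hev.fderiv_eq, hev.eq_of_nhds]
  rfl

end Pullback

end Chart

/-! ### Approximation in a chart -/

section Cutoff

variable {E : Type*} [NormedAddCommGroup E] [NormedSpace ℝ E]

theorem exists_cutoff [FiniteDimensional ℝ E] {K T : Set E} (hK : IsCompact K) (hT : IsOpen T)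
    (hKT : K ⊆ T) :
    ∃ κ : E → ℂ, ContDiff ℝ ∞ κ ∧ HasCompactSupport κ ∧ tsupport κ ⊆ T ∧ ∀ y ∈ K, κ y = 1 := by
  have : ProperSpace E := FiniteDimensional.proper_real E
  obtain ⟨L, hL, hKL, hLT⟩ := exists_compact_between hK hT hKT
  obtain ⟨f, hf1, hf0, -⟩ := exists_contMDiffMap_one_nhds_of_subset_interior (n := ⊤) 𝓘(ℝ, E)
    hK.isClosed hKL
  have h0 : ∀ y ∉ L, (f y : ℂ) = 0 := fun y hy => by rw [hf0 y hy, Complex.ofReal_zero]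
  exact ⟨fun y => (f y : ℂ), Complex.ofRealCLM.contDiff.comp f.contMDiff.contDiff,
    HasCompactSupport.intro hL h0,
    (closure_minimal (Function.support_subset_iff'.2 h0) hL.isClosed).trans hLT,
    fun y hy => by simp [hf1.self_of_nhdsSet y hy]⟩

theorem contDiff_mul_of_tsupport_subset {T : Set E} (hT : IsOpen T) {κ g : E → ℂ}
    (hκ : ContDiff ℝ ∞ κ) (hκT : tsupport κ ⊆ T) (hg : ContDiffOn ℝ ∞ g T) :
    ContDiff ℝ ∞ fun y => κ y * g y := by
  rw [contDiff_iff_contDiffAt]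
  intro y
  by_cases hy : y ∈ tsupport κ
  · exact hκ.contDiffAt.mul (hg.contDiffAt (hT.mem_nhds (hκT hy)))
  · refine contDiffAt_const (c := (0 : ℂ)) |>.congr_of_eventuallyEq ?_
    filter_upwards [notMem_tsupport_iff_eventuallyEq.1 hy] with z hz
    simp [hz]

end Cutoff

section Local

variable {n : ℕ} {M : Type*} [TopologicalSpace M] [ChartedSpace (EuclideanSpace ℝ (Fin n)) M]

/-- The constant function `1`. -/
noncomputable def oneSmooth (n : ℕ) (M : Type*) [TopologicalSpace M]
    [ChartedSpace (EuclideanSpace ℝ (Fin n)) M] : Smooth n M :=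
  ⟨fun _ => 1, contMDiff_const⟩

/-- The commutator `[P, χ]` of a first-order operator with multiplication by `χ`. It is
multiplication by the function `P χ - χ P 1`, which is how it is encoded here. -/
noncomputable def commutator (P : Smooth n M →ₗ[ℂ] Smooth n M) : Smooth n M →ₗ[ℂ] (M → ℂ) where
  toFun χ := (P χ).1 - χ.1 * (P (oneSmooth n M)).1
  map_add' f g := by
    rw [map_add]
    change (P f).1 + (P g).1 - (f.1 + g.1) * _ = _
    ring
  map_smul' c f := by
    rw [map_smul]
    change c • (P f).1 - (c • f.1) * _ = c • ((P f).1 - f.1 * _)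
    rw [smul_sub, smul_mul_assoc]

theorem commutator_oneSmooth (P : Smooth n M →ₗ[ℂ] Smooth n M) :
    commutator P (oneSmooth n M) = 0 := by
  ext x
  change (P (oneSmooth n M)).1 x - 1 * (P (oneSmooth n M)).1 x = 0
  ring

theorem continuous_smooth (f : Smooth n M) : Continuous f.1 := ContMDiff.continuous f.2

theorem continuous_commutator (P : Smooth n M →ₗ[ℂ] Smooth n M) (χ : Smooth n M) :
    Continuous (commutator P χ) :=
  (continuous_smooth _).sub ((continuous_smooth _).mul (continuous_smooth _))

theorem IsLocalForm.commutator_apply {P : Smooth n M →ₗ[ℂ] Smooth n M}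
    {e : OpenPartialHomeomorph M (EuclideanSpace ℝ (Fin n))}
    {a : Fin n → EuclideanSpace ℝ (Fin n) → ℂ} {b : EuclideanSpace ℝ (Fin n) → ℂ}
    (h : IsLocalForm P e a b) (χ : Smooth n M) {y : EuclideanSpace ℝ (Fin n)}
    (hy : y ∈ e.target) : commutator P χ (e.symm y) =
      ∑ j, a j y * fderiv ℝ (fun z => χ.1 (e.symm z)) y (stdDir n j) := by
  change (P χ).1 (e.symm y) - χ.1 (e.symm y) * (P (oneSmooth n M)).1 (e.symm y) = _
  rw [h.apply_eq χ y hy, h.apply_eq _ y hy]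
  simp [oneSmooth]
  ring

variable [MeasurableSpace M] [BorelSpace M] [CompactSpace M] {μ : Measure M}

theorem memLp_continuous_mul {f : M → ℂ} (hf : Continuous f) {u : M → ℂ} (hu : MemLp u 2 μ) :
    MemLp (f * u) 2 μ := by
  obtain ⟨C, hC⟩ := isCompact_univ.exists_bound_of_continuousOn hf.continuousOn
  refine hu.of_le_mul (c := C) (hf.aestronglyMeasurable.mul hu.1) (ae_of_all _ fun x => ?_)
  rw [Pi.mul_apply, norm_mul]
  gcongr
  exact hC x (mem_univ x)

variable [T2Space M] [IsManifold (𝓡 n) ∞ M] {P : Smooth n M →ₗ[ℂ] Smooth n M}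
  {e : OpenPartialHomeomorph M (EuclideanSpace ℝ (Fin n))}
  {ρ : EuclideanSpace ℝ (Fin n) → ℝ} {a : Fin n → EuclideanSpace ℝ (Fin n) → ℂ}
  {b : EuclideanSpace ℝ (Fin n) → ℂ} {u v : M → ℂ}

/-- If `P u = v` weakly and `χ` is supported in a chart, then in this chart
`P (χ u) = χ v + [P, χ] u` weakly, tested against all test functions on the coordinate space once
the coefficients have been cut off. -/
theorem integral_localization (he : e ∈ IsManifold.maximalAtlas (𝓡 n) ∞ M)
    (hρ : IsChartDensity μ e ρ) (hab : IsLocalForm P e a b) {χ : Smooth n M}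
    (hu : MemLp u 2 μ) (hv : MemLp v 2 μ) (huv : DistribEq P u v)
    {K : Set (EuclideanSpace ℝ (Fin n))} (hK : IsCompact K) (hKe : K ⊆ e.target)
    (hχK : ∀ y ∈ e.target, y ∉ K → χ.1 (e.symm y) = 0)
    {κ : EuclideanSpace ℝ (Fin n) → ℂ} (hκ : ContDiff ℝ ∞ κ) (hκe : tsupport κ ⊆ e.target)
    (hκ1 : ∀ y ∈ K, κ y = 1) {φ : EuclideanSpace ℝ (Fin n) → ℂ} (hφ : ContDiff ℝ ∞ φ)
    (hφc : HasCompactSupport φ) :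
    ∫ y, K.indicator ((χ.1 * u) ∘ e.symm) y *
        transposeOp (stdDir n) (fun j y => κ y * a j y) (fun y => κ y * b y) φ y
      = ∫ y, K.indicator ((χ.1 * v + commutator P χ * u) ∘ e.symm) y * φ y := by
  have ha' : ∀ j, ContDiff ℝ ∞ fun y => κ y * a j y := fun j =>
    contDiff_mul_of_tsupport_subset e.open_target hκ hκe (hab.smooth_a j)
  have hb' : ContDiff ℝ ∞ fun y => κ y * b y :=
    contDiff_mul_of_tsupport_subset e.open_target hκ hκe hab.smooth_b
  have hf := contDiffOn_comp_symm he χ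
  set f : EuclideanSpace ℝ (Fin n) → ℂ := fun y => χ.1 (e.symm y) with hfdef
  -- the equation `P u = v` is tested against `θ`
  set θ : EuclideanSpace ℝ (Fin n) → ℂ := fun y => κ y * f y * φ y with hθ
  have hθs : ContDiff ℝ ∞ θ := (contDiff_mul_of_tsupport_subset e.open_target hκ hκe hf).mul hφ
  have hθ0 : ∀ y ∉ K, θ y = 0 := by
    intro y hy
    by_cases hye : y ∈ e.target
    · simp [hθ, hfdef, hχK y hye hy]
    · simp [hθ, image_eq_zero_of_notMem_tsupport fun h => hye (hκe h)]
  have hθK : tsupport θ ⊆ K :=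
    closure_minimal (Function.support_subset_iff'.2 hθ0) hK.isClosed
  have hmain := huv e he a b hab θ hθs (HasCompactSupport.intro hK hθ0) (hθK.trans hKe)
  have hQm : MemLp (K.indicator ((commutator P χ * u) ∘ e.symm)) 2 :=
    hρ.memLp_comp_symm (memLp_continuous_mul (continuous_commutator P χ) hu) hK hKe
  have hUm : MemLp (K.indicator ((χ.1 * u) ∘ e.symm)) 2 :=
    hρ.memLp_comp_symm (memLp_continuous_mul (continuous_smooth χ) hu) hK hKe
  have hVm : MemLp (K.indicator ((χ.1 * v) ∘ e.symm)) 2 :=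
    hρ.memLp_comp_symm (memLp_continuous_mul (continuous_smooth χ) hv) hK hKe
  have hint : ∀ {F g : EuclideanSpace ℝ (Fin n) → ℂ}, MemLp F 2 → Continuous g →
      HasCompactSupport g → Integrable fun y => F y * g y := fun hF hg hgc => by
    simpa [mul_comm] using (hF.locallyIntegrable (by norm_num)
      ).integrable_smul_left_of_hasCompactSupport hg hgc
  have h1 : ∀ y, u (e.symm y) * transposeOp (stdDir n) a b θ y
      = K.indicator ((χ.1 * u) ∘ e.symm) y *
          transposeOp (stdDir n) (fun j y => κ y * a j y) (fun y => κ y * b y) φ y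
        - K.indicator ((commutator P χ * u) ∘ e.symm) y * φ y := by
    intro y
    by_cases hy : y ∈ K
    · have hye := hKe hy
      have hfd : ∀ j, fderiv ℝ (fun z => a j z * θ z) y (stdDir n j)
          = f y * fderiv ℝ (fun z => κ z * a j z * φ z) y (stdDir n j)
            + κ y * a j y * φ y * fderiv ℝ f y (stdDir n j) := by
        intro j
        have hfun : (fun z => a j z * θ z) = fun z => f z * (κ z * a j z * φ z) := by
          ext z
          simp only [hθ]
          ring
        rw [hfun, fderiv_fun_mul ((hf.contDiffAt (e.open_target.mem_nhds hye)).differentiableAt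
          (by simp)) (((ha' j).mul hφ).differentiable (by simp) y)]
        simp
      rw [indicator_of_mem hy, indicator_of_mem hy]
      simp only [Function.comp_apply, Pi.mul_apply, transposeOp, hfd, hκ1 y hy, one_mul,
        hab.commutator_apply χ hye, Finset.sum_add_distrib, ← Finset.mul_sum]
      have e1 : ∑ j, a j y * φ y * fderiv ℝ f y (stdDir n j)
          = (∑ j, a j y * fderiv ℝ f y (stdDir n j)) * φ y := by
        rw [Finset.sum_mul]
        exact Finset.sum_congr rfl fun j _ => by ring
      rw [e1]
      simp only [hθ, hκ1 y hy, hfdef]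
      ring
    · rw [transposeOp_eq_zero fun h => hy (hθK h), indicator_of_notMem hy, indicator_of_notMem hy]
      ring
  have h2 : ∀ y, v (e.symm y) * θ y = K.indicator ((χ.1 * v) ∘ e.symm) y * φ y := by
    intro y
    by_cases hy : y ∈ K
    · rw [indicator_of_mem hy]
      simp only [hθ, hκ1 y hy, hfdef, Function.comp_apply, Pi.mul_apply]
      ring
    · rw [indicator_of_notMem hy, hθ0 y hy]
      ring
  have h3 : ∫ y, u (e.symm y) * transposeOp (stdDir n) a b θ y = ∫ y, v (e.symm y) * θ y := hmain
  simp only [h1, h2] at h3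
  rw [integral_sub (hint hUm (contDiff_transposeOp ha' hb' hφ).continuous
    (hasCompactSupport_transposeOp hφc)) (hint hQm hφ.continuous hφc), sub_eq_iff_eq_add] at h3
  rw [h3, ← integral_add (hint hVm hφ.continuous hφc) (hint hQm hφ.continuous hφc)]
  congr with y
  rw [← add_mul, ← Pi.add_apply, ← indicator_add']
  rfl

/-- The Euclidean approximation transported to the manifold: if `P u = v` weakly and `χ` is supported
in a chart, then `(χ u, χ v + [P, χ] u)` is an `L²`-limit of pairs `(w, P w)` with `w` smooth. -/
theorem exists_smooth_approx_of_tsupport_subset (he : e ∈ IsManifold.maximalAtlas (𝓡 n) ∞ M)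
    (hρ : IsChartDensity μ e ρ) (hP : IsDiffOpDegreeOne P) {χ : Smooth n M}
    (hχ : tsupport χ.1 ⊆ e.source) (hu : MemLp u 2 μ) (hv : MemLp v 2 μ)
    (huv : DistribEq P u v) {δ : ℝ} (hδ : 0 < δ) :
    ∃ w : Smooth n M, eLpNorm (w.1 - χ.1 * u) 2 μ ≤ ENNReal.ofReal δ ∧
      eLpNorm ((P w).1 - (χ.1 * v + commutator P χ * u)) 2 μ ≤ ENNReal.ofReal δ := by
  obtain ⟨a, b, hab⟩ := hP e he
  set K := e '' tsupport χ.1 with hKdef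
  have hK : IsCompact K :=
    ((isClosed_tsupport _).isCompact).image_of_continuousOn (e.continuousOn.mono hχ)
  have hKe : K ⊆ e.target := by
    rintro _ ⟨x, hx, rfl⟩
    exact e.map_source (hχ hx)
  -- the approximating test functions are supported in the neighborhood `K'` of `K`, on which the
  -- cutoff `κ` of the coefficients equals `1` and the density is comparable to Lebesgue measure
  obtain ⟨K', hK', hKK', hK'e⟩ := exists_compact_between hK e.open_target hKe
  obtain ⟨κ, hκ, hκc, hκe, hκ1⟩ := exists_cutoff hK' e.open_target hK'e
  have hKK := hKK'.trans interior_subset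
  have hχ0 : ∀ y ∈ e.target, y ∉ K → e.symm y ∉ tsupport χ.1 := fun y hy hyK h =>
    hyK ⟨_, h, e.right_inv hy⟩
  have hχK : ∀ y ∈ e.target, y ∉ K → χ.1 (e.symm y) = 0 := fun y hy hyK =>
    image_eq_zero_of_notMem_tsupport (hχ0 y hy hyK)
  have hcomm0 : ∀ x ∉ tsupport χ.1, commutator P χ x = 0 := by
    intro x hx
    change (P χ).1 x - χ.1 x * _ = 0
    rw [hP.apply_eq_zero χ hx, image_eq_zero_of_notMem_tsupport hx, zero_mul, sub_zero]
  have hVmem : MemLp (χ.1 * v + commutator P χ * u) 2 μ :=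
    (memLp_continuous_mul (continuous_smooth χ) hv).add
      (memLp_continuous_mul (continuous_commutator P χ) hu)
  have hUmem : MemLp (χ.1 * u) 2 μ := memLp_continuous_mul (continuous_smooth χ) hu
  obtain ⟨C, hC, hCle⟩ := hρ.exists_eLpNorm_le hK' hK'e
  obtain ⟨W, hW, hWc, hWK', hW1, hW2⟩ := exists_testFunction_approx (d := stdDir n)
    (a := fun j y => κ y * a j y) (b := fun y => κ y * b y)
    (fun j => contDiff_mul_of_tsupport_subset e.open_target hκ hκe (hab.smooth_a j))
    (fun j => hκc.mul_right)
    (contDiff_mul_of_tsupport_subset e.open_target hκ hκe hab.smooth_b) hκc.mul_right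
    (hρ.memLp_comp_symm hUmem hK hKe) (hρ.memLp_comp_symm hVmem hK hKe) hK isOpen_interior hKK'
    (fun y hy => indicator_of_notMem hy _)
    (fun φ hφ hφc => integral_localization he hρ hab hu hv huv hK hKe hχK hκ hκe
      (fun y hy => hκ1 y (hKK hy)) hφ hφc)
    (δ := δ / (C.toReal + 1)) (by positivity)
  have hWe : tsupport W ⊆ e.target := hWK'.trans (interior_subset.trans hK'e)
  have hCδ : C * ENNReal.ofReal (δ / (C.toReal + 1)) ≤ ENNReal.ofReal δ := by
    rw [← ENNReal.ofReal_toReal hC, ← ENNReal.ofReal_mul ENNReal.toReal_nonneg,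
      ENNReal.toReal_ofReal ENNReal.toReal_nonneg]
    refine ENNReal.ofReal_le_ofReal ?_
    rw [mul_div_assoc', div_le_iff₀ (by positivity)]
    nlinarith [ENNReal.toReal_nonneg (a := C)]
  set w := pullback he hW hWc hWe with hw
  have hoff : ∀ x, ¬(x ∈ e.source ∧ e x ∈ K') → x ∉ tsupport χ.1 ∧ x ∉ tsupport w.1 := by
    refine fun x hx => ⟨fun h => hx ⟨hχ h, hKK ⟨x, h, rfl⟩⟩, fun h => hx ?_⟩
    obtain ⟨y, hy, rfl⟩ := tsupport_pullback_subset hWc hWe h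
    refine ⟨e.map_target (hWe hy), ?_⟩
    rw [e.right_inv (hWe hy)]
    exact interior_subset (hWK' hy)
  have hWoff : ∀ y ∉ K', y ∉ tsupport W := fun y hy h => hy (interior_subset (hWK' h))
  refine ⟨w, ?_, ?_⟩
  · refine (hCle _ ((continuous_smooth w).aestronglyMeasurable.sub hUmem.1) fun x hx => ?_).trans
      (le_trans ?_ hCδ)
    · simp [image_eq_zero_of_notMem_tsupport (hoff x hx).1,
        image_eq_zero_of_notMem_tsupport (hoff x hx).2]
    · refine le_of_eq_of_le ?_ (mul_le_mul_right hW1 C)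
      congr 2 with y
      by_cases hy : y ∈ K'
      · rw [indicator_of_mem hy]
        simp only [Function.comp_apply, Pi.sub_apply, Pi.mul_apply]
        rw [hw, pullback_symm_apply he hW hWc hWe (hK'e hy)]
        by_cases hyK : y ∈ K
        · rw [indicator_of_mem hyK]
          rfl
        · rw [indicator_of_notMem hyK, hχK y (hK'e hy) hyK, zero_mul]
      · rw [indicator_of_notMem hy, Pi.sub_apply, indicator_of_notMem fun h => hy (hKK h),
          image_eq_zero_of_notMem_tsupport (hWoff y hy), sub_zero]
  · refine (hCle _ ((continuous_smooth _).aestronglyMeasurable.sub hVmem.1) fun x hx => ?_).trans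
      (le_trans ?_ hCδ)
    · simp [image_eq_zero_of_notMem_tsupport (hoff x hx).1, hcomm0 x (hoff x hx).1,
        hP.apply_eq_zero w (hoff x hx).2]
    · refine le_of_eq_of_le ?_ (mul_le_mul_right hW2 C)
      congr 2 with y
      by_cases hy : y ∈ K'
      · have hAW : (P w).1 (e.symm y) = firstOrderOp (stdDir n) (fun j y => κ y * a j y)
            (fun y => κ y * b y) W y := by
          rw [hw, hab.pullback_apply he hW hWc hWe (hK'e hy)]
          simp [firstOrderOp, hκ1 y hy]
        rw [indicator_of_mem hy]
        simp only [Function.comp_apply, Pi.sub_apply, Pi.mul_apply, Pi.add_apply, hAW]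
        by_cases hyK : y ∈ K
        · rw [indicator_of_mem hyK]
          rfl
        · rw [indicator_of_notMem hyK, hχK y (hK'e hy) hyK, hcomm0 _ (hχ0 y (hK'e hy) hyK)]
          simp
      · rw [indicator_of_notMem hy, Pi.sub_apply, indicator_of_notMem fun h => hy (hKK h),
          firstOrderOp_eq_zero (hWoff y hy), sub_zero]

end Local

/-! ### Globalization -/

section Global

variable {n : ℕ} {M : Type*} [TopologicalSpace M] [T2Space M] [CompactSpace M]
  [ChartedSpace (EuclideanSpace ℝ (Fin n)) M] [IsManifold (𝓡 n) ∞ M]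

theorem exists_partition_of_unity (n : ℕ) (M : Type*) [TopologicalSpace M] [T2Space M]
    [CompactSpace M] [ChartedSpace (EuclideanSpace ℝ (Fin n)) M] [IsManifold (𝓡 n) ∞ M] :
    ∃ (t : Finset M) (χ : M → Smooth n M),
      (∀ i, tsupport (χ i).1 ⊆ (chartAt (EuclideanSpace ℝ (Fin n)) i).source) ∧
      ∑ i ∈ t, χ i = oneSmooth n M := by
  obtain ⟨f, hf⟩ := SmoothPartitionOfUnity.exists_isSubordinate_chartAt_source (𝓡 n) M
  have hfin := f.locallyFinite.finite_nonempty_of_compact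
  refine ⟨hfin.toFinset, fun i => ⟨fun x => (f i x : ℂ),
    Complex.ofRealCLM.contDiff.contMDiff.comp (f i).contMDiff⟩, fun i => ?_, ?_⟩
  · refine (closure_mono ?_).trans (hf i)
    intro x hx h
    exact hx (by simp [h])
  · ext x
    have h1 := f.sum_eq_one (mem_univ x)
    rw [finsum_eq_sum_of_support_subset (s := hfin.toFinset) _ (by
      intro i hi
      simp only [Finite.coe_toFinset, mem_ofPred_eq]
      exact ⟨x, hi⟩)] at h1
    simp only [AddSubmonoidClass.coe_finsetSum, Finset.sum_apply, oneSmooth]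
    exact_mod_cast h1

variable [MeasurableSpace M] [BorelSpace M] {μ : Measure M} {P : Smooth n M →ₗ[ℂ] Smooth n M}

theorem exists_isChartDensity (hμ : IsSmoothDensity n μ)
    {e : OpenPartialHomeomorph M (EuclideanSpace ℝ (Fin n))}
    (he : e ∈ IsManifold.maximalAtlas (𝓡 n) ∞ M) : ∃ ρ, IsChartDensity μ e ρ := by
  obtain ⟨ρ, h1, h2, h3⟩ := hμ e he
  exact ⟨ρ, h1, h2, h3⟩

theorem mem_graph_unbounded (hμ : IsSmoothDensity n μ) {p : Lp ℂ 2 μ × Lp ℂ 2 μ} :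
    p ∈ (unbounded hμ P).graph ↔ ∃ f : Smooth n M, p = (toL2 hμ f, toL2 hμ (P f)) := by
  have happ : ∀ f : Smooth n M, unbounded hμ P ⟨toL2 hμ f, LinearMap.mem_range_self _ f⟩
      = toL2 hμ (P f) := by
    intro f
    have : (LinearEquiv.ofInjective (toL2 hμ) (toL2_injective hμ)).symm
        ⟨toL2 hμ f, LinearMap.mem_range_self _ f⟩ = f := by
      rw [LinearEquiv.symm_apply_eq]
      rfl
    exact congrArg (fun g => toL2 hμ (P g)) this
  rw [LinearPMap.mem_graph_iff]
  constructor
  · rintro ⟨⟨_, f, rfl⟩, h1, h2⟩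
    refine ⟨f, Prod.ext h1.symm ?_⟩
    rw [← h2, happ]
  · rintro ⟨f, rfl⟩
    exact ⟨⟨toL2 hμ f, LinearMap.mem_range_self _ f⟩, rfl, happ f⟩

theorem coeFn_sum_toLp {ι α : Type*} [MeasurableSpace α] {μ : Measure α} (t : Finset ι)
    {f : ι → α → ℂ} (hf : ∀ i, MemLp (f i) 2 μ) :
    ⇑(∑ i ∈ t, (hf i).toLp (f i)) =ᵐ[μ] fun x => ∑ i ∈ t, f i x := by
  classical
  induction t using Finset.induction_on with
  | empty =>
    simp only [Finset.sum_empty]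
    exact Lp.coeFn_zero _ _ _
  | insert i t hi ih =>
    rw [Finset.sum_insert hi]
    filter_upwards [Lp.coeFn_add ((hf i).toLp (f i)) (∑ i ∈ t, (hf i).toLp (f i)), ih,
      (hf i).coeFn_toLp] with x h1 h2 h3
    rw [h1, Pi.add_apply, h2, h3, Finset.sum_insert hi]

/-- Weak solutions are limits in the graph norm: `(u, v)` is the sum over a partition of unity of
the pairs `(χ u, χ v + [P, χ] u)`, because the commutators add up to `[P, 1] = 0`. -/
theorem mem_closure_graph_of_distribEq (hμ : IsSmoothDensity n μ) (hP : IsDiffOpDegreeOne P)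
    {u v : M → ℂ} (hu : MemLp u 2 μ) (hv : MemLp v 2 μ) (huv : DistribEq P u v) :
    (hu.toLp u, hv.toLp v) ∈ (unbounded hμ P).graph.topologicalClosure := by
  obtain ⟨t, χ, hχ, hsum⟩ := exists_partition_of_unity n M
  have hm₁ : ∀ i, MemLp ((χ i).1 * u) 2 μ := fun i =>
    memLp_continuous_mul (continuous_smooth _) hu
  have hm₂ : ∀ i, MemLp ((χ i).1 * v + commutator P (χ i) * u) 2 μ := fun i =>
    (memLp_continuous_mul (continuous_smooth _) hv).add
      (memLp_continuous_mul (continuous_commutator P _) hu)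
  have hloc : ∀ i, ((hm₁ i).toLp _, (hm₂ i).toLp _)
      ∈ (unbounded hμ P).graph.topologicalClosure := by
    intro i
    have he := IsManifold.chart_mem_maximalAtlas (I := 𝓡 n) (n := ∞) i
    obtain ⟨ρ, hρ⟩ := exists_isChartDensity hμ he
    refine Metric.mem_closure_iff.2 fun ε hε => ?_
    obtain ⟨w, hw1, hw2⟩ := exists_smooth_approx_of_tsupport_subset he hρ hP (hχ i) hu hv huv
      (half_pos hε)
    have key : ∀ {f : M → ℂ} (hf : MemLp f 2 μ) (g : Smooth n M),
        eLpNorm (g.1 - f) 2 μ ≤ ENNReal.ofReal (ε / 2) → dist (hf.toLp f) (toL2 hμ g) < ε := by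
      intro f hf g hg
      rw [dist_comm]
      change dist ((memLp_smooth hμ g).toLp g.1) (hf.toLp f) < ε
      rw [dist_eq_norm, ← MemLp.toLp_sub]
      have := norm_toLp_le ((memLp_smooth hμ g).sub hf) ENNReal.ofReal_ne_top hg
      rw [ENNReal.toReal_ofReal (half_pos hε).le] at this
      linarith
    exact ⟨_, (mem_graph_unbounded hμ).2 ⟨w, rfl⟩, by
      rw [Prod.dist_eq]
      exact max_lt (key (hm₁ i) _ hw1) (key (hm₂ i) _ hw2)⟩
  have hone : ∀ x, ∑ i ∈ t, (χ i).1 x = 1 := by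
    intro x
    have := congrArg (fun f : Smooth n M => f.1 x) hsum
    simpa [oneSmooth] using this
  have hcomm : ∀ x, ∑ i ∈ t, commutator P (χ i) x = 0 := by
    intro x
    rw [← Finset.sum_apply, ← map_sum, hsum, commutator_oneSmooth]
    rfl
  have hdecomp : (hu.toLp u, hv.toLp v) = ∑ i ∈ t, ((hm₁ i).toLp _, (hm₂ i).toLp _) := by
    refine Prod.ext (Lp.ext ?_) (Lp.ext ?_)
    · rw [Prod.fst_sum]
      filter_upwards [coeFn_sum_toLp t hm₁, hu.coeFn_toLp] with x hx hux
      rw [hux, hx]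
      simp only [Pi.mul_apply]
      rw [← Finset.sum_mul, hone, one_mul]
    · rw [Prod.snd_sum]
      filter_upwards [coeFn_sum_toLp t hm₂, hv.coeFn_toLp] with x hx hvx
      rw [hvx, hx]
      simp only [Pi.add_apply, Pi.mul_apply]
      rw [Finset.sum_add_distrib, ← Finset.sum_mul, ← Finset.sum_mul, hone, hcomm]
      ring
  rw [hdecomp]
  exact Submodule.sum_mem _ fun i _ => hloc i

/-! ### Density of smooth functions -/

theorem dense_range_toL2 (hμ : IsSmoothDensity n μ) :
    Dense (LinearMap.range (toL2 hμ) : Set (Lp ℂ 2 μ)) := by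
  have := hμ.isFiniteMeasure
  have := Manifold.metrizableSpace (𝓡 n) M
  let ι : Smooth n M → C(M, ℂ) := fun f => ⟨f.1, continuous_smooth f⟩
  have hι : DenseRange ι := by
    refine Metric.denseRange_iff.2 fun g ε hε => ?_
    obtain ⟨h, hh, -⟩ := g.continuous.exists_contMDiff_approx (𝓡 n) ⊤
      (ε := fun _ => ε / 2) continuous_const (fun _ => half_pos hε)
    refine ⟨⟨h, h.contMDiff⟩, lt_of_le_of_lt ?_ (half_lt_self hε)⟩
    refine (ContinuousMap.dist_le (half_pos hε).le).2 fun x => ?_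
    rw [dist_comm]
    exact (hh x).le
  have hd : DenseRange (ContinuousMap.toLp (E := ℂ) 2 μ ℂ ∘ ι) :=
    (ContinuousMap.toLp_denseRange ℂ μ ℂ (p := 2) (by norm_num)).comp hι
      (ContinuousMap.toLp (E := ℂ) 2 μ ℂ).continuous
  have heq : (LinearMap.range (toL2 hμ) : Set (Lp ℂ 2 μ))
      = range (ContinuousMap.toLp (E := ℂ) 2 μ ℂ ∘ ι) := by
    rw [LinearMap.coe_range]
    rfl
  rw [heq]
  exact hd

end Global

/-! ### The adjoint of a formally self-adjoint operator -/

section Adjoint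

variable {n : ℕ} {M : Type*} [TopologicalSpace M] [T2Space M] [CompactSpace M]
  [ChartedSpace (EuclideanSpace ℝ (Fin n)) M] [IsManifold (𝓡 n) ∞ M] [MeasurableSpace M]
  [BorelSpace M] {μ : Measure M} {P : Smooth n M →ₗ[ℂ] Smooth n M}

theorem IsChartDensity.integral_mul_conj_eq
    {e : OpenPartialHomeomorph M (EuclideanSpace ℝ (Fin n))}
    {ρ : EuclideanSpace ℝ (Fin n) → ℝ} (hρ : IsChartDensity μ e ρ) {u : M → ℂ}
    (hu : AEStronglyMeasurable u μ) (f : Smooth n M) (h0 : ∀ x ∉ e.source, u x = 0 ∨ f.1 x = 0) :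
    ∫ x, u x * (starRingEnd ℂ) (f.1 x) ∂μ
      = ∫ y in e.target, ρ y * (u (e.symm y) * (starRingEnd ℂ) (f.1 (e.symm y))) :=
  hρ.integral_eq (F := fun x => u x * (starRingEnd ℂ) (f.1 x))
    (hu.mul (Complex.continuous_conj.comp (continuous_smooth f)).aestronglyMeasurable)
    fun x hx => by rcases h0 x hx with h | h <;> simp [h]

/-- In a chart with density `ρ`, formal self-adjointness says that the conjugate of `P w`, times
`ρ`, is the transpose of `P` applied to `φ = ρ w̄`. -/
theorem density_mul_conj_eq_transposeOp {e : OpenPartialHomeomorph M (EuclideanSpace ℝ (Fin n))}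
    (he : e ∈ IsManifold.maximalAtlas (𝓡 n) ∞ M) {ρ : EuclideanSpace ℝ (Fin n) → ℝ}
    (hρ : IsChartDensity μ e ρ) (hsa : IsFormallySelfAdjoint μ P)
    {a : Fin n → EuclideanSpace ℝ (Fin n) → ℂ} {b : EuclideanSpace ℝ (Fin n) → ℂ}
    (hab : IsLocalForm P e a b) (hP : IsDiffOpDegreeOne P)
    {φ : EuclideanSpace ℝ (Fin n) → ℂ} (hφ : ContDiff ℝ ∞ φ) (hφc : HasCompactSupport φ)
    (hφe : tsupport φ ⊆ e.target) (w : Smooth n M)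
    (hwφ : ∀ y ∈ e.target, ρ y * (starRingEnd ℂ) (w.1 (e.symm y)) = φ y) :
    ∀ᵐ y, y ∈ e.target →
      ρ y * (starRingEnd ℂ) ((P w).1 (e.symm y)) = transposeOp (stdDir n) a b φ y := by
  -- the coefficients are smooth in the chart only; a cutoff equal to `1` on the support of `φ`
  -- makes them global without changing the transpose at `φ`
  obtain ⟨κ, hκ, hκc, hκe, hκ1⟩ := exists_cutoff hφc e.open_target hφe
  have hκφ : ∀ y, κ y * φ y = φ y := by
    intro y
    by_cases hy : y ∈ tsupport φ
    · rw [hκ1 y hy, one_mul]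
    · rw [image_eq_zero_of_notMem_tsupport hy, mul_zero]
  have ha' : ∀ j, ContDiff ℝ ∞ fun y => κ y * a j y := fun j =>
    contDiff_mul_of_tsupport_subset e.open_target hκ hκe (hab.smooth_a j)
  have hb' : ContDiff ℝ ∞ fun y => κ y * b y :=
    contDiff_mul_of_tsupport_subset e.open_target hκ hκe hab.smooth_b
  have htr : transposeOp (stdDir n) a b φ
      = transposeOp (stdDir n) (fun j y => κ y * a j y) (fun y => κ y * b y) φ := by
    have h1 : ∀ (g : EuclideanSpace ℝ (Fin n) → ℂ) y, κ y * g y * φ y = g y * φ y := fun g y => by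
      rw [mul_right_comm, hκφ, mul_comm]
    ext y
    simp only [transposeOp, h1]
  have htrs : ContDiff ℝ ∞ (transposeOp (stdDir n) a b φ) := by
    rw [htr]
    exact contDiff_transposeOp ha' hb' hφ
  set q : EuclideanSpace ℝ (Fin n) → ℂ :=
    fun y => ρ y * (starRingEnd ℂ) ((P w).1 (e.symm y)) with hq
  have hqs : ContDiffOn ℝ ∞ q e.target :=
    (Complex.ofRealCLM.contDiff.comp_contDiffOn hρ.contDiffOn).mul
      (Complex.conjCLE.contDiff.comp_contDiffOn (contDiffOn_comp_symm he (P w)))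
  -- by the fundamental lemma of the calculus of variations, it suffices to test against `g`
  have hzero : ∀ᵐ y, y ∈ e.target → q y - transposeOp (stdDir n) a b φ y = 0 := by
    refine e.open_target.ae_eq_zero_of_integral_contDiff_smul_eq_zero
      ((hqs.continuousOn.sub htrs.continuous.continuousOn).locallyIntegrableOn
        e.open_target.measurableSet) fun g hg hgc hge => ?_
    set Z : EuclideanSpace ℝ (Fin n) → ℂ := fun y => (g y : ℂ) with hZ
    have hZs : ContDiff ℝ ∞ Z := Complex.ofRealCLM.contDiff.comp hg
    have hZc : HasCompactSupport Z := hgc.comp_left (g := Complex.ofReal) Complex.ofReal_zero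
    have hZe : tsupport Z ⊆ e.target := by
      refine (closure_mono (Function.support_subset_iff'.2 fun y hy => ?_)).trans hge
      simp [hZ, Function.notMem_support.1 hy]
    set z := pullback he hZs hZc hZe with hz
    have hzoff : ∀ x ∉ e.source, x ∉ tsupport z.1 := fun x hx h => by
      obtain ⟨y, hy, rfl⟩ := tsupport_pullback_subset hZc hZe h
      exact hx (e.map_target (hZe hy))
    have hfsa := hsa z w
    rw [hρ.integral_mul_conj_eq (continuous_smooth (P z)).aestronglyMeasurable w
        (fun x hx => Or.inl (hP.apply_eq_zero z (hzoff x hx))),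
      hρ.integral_mul_conj_eq (continuous_smooth z).aestronglyMeasurable (P w)
        (fun x hx => Or.inl (image_eq_zero_of_notMem_tsupport (hzoff x hx)))] at hfsa
    have hleft : ∫ y in e.target, ρ y * ((P z).1 (e.symm y) * (starRingEnd ℂ) (w.1 (e.symm y)))
        = ∫ y, Z y * transposeOp (stdDir n) a b φ y := by
      rw [htr, ← integral_firstOrderOp_mul ha' hb' hZs hφ hφc]
      symm
      rw [← setIntegral_eq_integral_of_forall_compl_eq_zero (s := e.target)
          (fun y hy => by rw [image_eq_zero_of_notMem_tsupport fun h => hy (hφe h), mul_zero])]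
      refine setIntegral_congr_fun e.open_target.measurableSet fun y hy => ?_
      have h1 : firstOrderOp (stdDir n) (fun j y => κ y * a j y) (fun y => κ y * b y) Z y * φ y
          = firstOrderOp (stdDir n) a b Z y * φ y := by
        have : firstOrderOp (stdDir n) (fun j y => κ y * a j y) (fun y => κ y * b y) Z y
            = κ y * firstOrderOp (stdDir n) a b Z y := by
          simp only [firstOrderOp, mul_add, Finset.mul_sum, mul_assoc]
        rw [this, mul_right_comm, hκφ, mul_comm]
      change firstOrderOp _ _ _ Z y * φ y = _
      rw [h1, hz, hab.pullback_apply he hZs hZc hZe hy, ← hwφ y hy]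
      ring
    have hright : ∫ y in e.target, ρ y * (z.1 (e.symm y) * (starRingEnd ℂ) ((P w).1 (e.symm y)))
        = ∫ y, Z y * q y := by
      symm
      rw [← setIntegral_eq_integral_of_forall_compl_eq_zero (s := e.target)
          (fun y hy => by rw [image_eq_zero_of_notMem_tsupport fun h => hy (hZe h), zero_mul])]
      refine setIntegral_congr_fun e.open_target.measurableSet fun y hy => ?_
      rw [hz, pullback_symm_apply he hZs hZc hZe hy, hq]
      ring
    rw [hleft, hright] at hfsa
    have hI1 : Integrable fun y => Z y * q y :=
      (contDiff_mul_of_tsupport_subset e.open_target hZs hZe hqs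
        ).continuous.integrable_of_hasCompactSupport hZc.mul_right
    have hI2 : Integrable fun y => Z y * transposeOp (stdDir n) a b φ y :=
      (hZs.mul htrs).continuous.integrable_of_hasCompactSupport hZc.mul_right
    have hfun : ∀ y, g y • (q y - transposeOp (stdDir n) a b φ y)
        = Z y * q y - Z y * transposeOp (stdDir n) a b φ y := fun y => by
      rw [Complex.real_smul, mul_sub]
    simp only [hfun]
    rw [integral_sub hI1 hI2, hfsa, sub_self]
  filter_upwards [hzero] with y hy hye
  exact sub_eq_zero.1 (hy hye)

/-- For a formally self-adjoint operator, an element of the graph of the Hilbert space adjoint is a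
weak solution: the adjoint relation is tested against `w = φ̄ / ρ`. -/
theorem distribEq_of_forall_integral_eq (hμ : IsSmoothDensity n μ) (hP : IsDiffOpDegreeOne P)
    (hsa : IsFormallySelfAdjoint μ P) {u v : M → ℂ} (hu : AEStronglyMeasurable u μ)
    (hv : AEStronglyMeasurable v μ)
    (h : ∀ f : Smooth n M, ∫ x, u x * (starRingEnd ℂ) ((P f).1 x) ∂μ
      = ∫ x, v x * (starRingEnd ℂ) (f.1 x) ∂μ) : DistribEq P u v := by
  intro e he a b hab φ hφ hφc hφe
  obtain ⟨ρ, hρ⟩ := exists_isChartDensity hμ he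
  have hρ0 : ∀ y ∈ e.target, (ρ y : ℂ) ≠ 0 := fun y hy =>
    Complex.ofReal_ne_zero.2 (hρ.pos y hy).ne'
  have hρs : ContDiffOn ℝ ∞ (fun y => (ρ y : ℂ)⁻¹) e.target :=
    (Complex.ofRealCLM.contDiff.comp_contDiffOn hρ.contDiffOn).inv hρ0
  set ψ : EuclideanSpace ℝ (Fin n) → ℂ := fun y => (starRingEnd ℂ) (φ y * (ρ y : ℂ)⁻¹) with hψ
  have hψs : ContDiff ℝ ∞ ψ := Complex.conjCLE.contDiff.comp
    (contDiff_mul_of_tsupport_subset e.open_target hφ hφe hρs)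
  have hψ0 : ∀ y ∉ tsupport φ, ψ y = 0 := fun y hy => by
    simp [hψ, image_eq_zero_of_notMem_tsupport hy]
  have hψc : HasCompactSupport ψ := HasCompactSupport.intro hφc hψ0
  have hψe : tsupport ψ ⊆ e.target :=
    (closure_minimal (Function.support_subset_iff'.2 hψ0) (isClosed_tsupport _)).trans hφe
  set w := pullback he hψs hψc hψe with hw
  have hwφ : ∀ y ∈ e.target, ρ y * (starRingEnd ℂ) (w.1 (e.symm y)) = φ y := by
    intro y hy
    rw [hw, pullback_symm_apply he hψs hψc hψe hy, hψ]
    simp only [Complex.conj_conj]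
    rw [mul_left_comm, mul_inv_cancel₀ (hρ0 y hy), mul_one]
  have hwoff : ∀ x ∉ e.source, x ∉ tsupport w.1 := fun x hx hxw => by
    obtain ⟨y, hy, rfl⟩ := tsupport_pullback_subset hψc hψe hxw
    exact hx (e.map_target (hψe hy))
  have hkey := density_mul_conj_eq_transposeOp he hρ hsa hab hP hφ hφc hφe w hwφ
  have hmain := h w
  rw [hρ.integral_mul_conj_eq hu (P w)
      (fun x hx => Or.inr (hP.apply_eq_zero w (hwoff x hx))),
    hρ.integral_mul_conj_eq hv w
      (fun x hx => Or.inr (image_eq_zero_of_notMem_tsupport (hwoff x hx)))] at hmain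
  have hl : ∫ y, u (e.symm y) * transposeOp (stdDir n) a b φ y
      = ∫ y in e.target, ρ y * (u (e.symm y) * (starRingEnd ℂ) ((P w).1 (e.symm y))) := by
    rw [← setIntegral_eq_integral_of_forall_compl_eq_zero (s := e.target)
      (fun y hy => by rw [transposeOp_eq_zero fun h => hy (hφe h), mul_zero])]
    refine setIntegral_congr_ae e.open_target.measurableSet ?_
    filter_upwards [hkey] with y hy hye
    rw [← hy hye]
    ring
  have hr : ∫ y, v (e.symm y) * φ y
      = ∫ y in e.target, ρ y * (v (e.symm y) * (starRingEnd ℂ) (w.1 (e.symm y))) := by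
    rw [← setIntegral_eq_integral_of_forall_compl_eq_zero (s := e.target)
      (fun y hy => by rw [image_eq_zero_of_notMem_tsupport fun h => hy (hφe h), mul_zero])]
    refine setIntegral_congr_fun e.open_target.measurableSet fun y hy => ?_
    rw [← hwφ y hy]
    ring
  change ∫ y, u (e.symm y) * transposeOp (stdDir n) a b φ y = _
  rw [hl, hr]
  exact hmain

theorem isEssentiallySelfAdjoint_unbounded (hμ : IsSmoothDensity n μ) (hP : IsDiffOpDegreeOne P)
    (hsa : IsFormallySelfAdjoint μ P) : IsEssentiallySelfAdjoint (unbounded hμ P) := by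
  have hd : Dense ((unbounded hμ P).domain : Set (Lp ℂ 2 μ)) := dense_range_toL2 hμ
  have hinner : ∀ (f : Smooth n M) (u : Lp ℂ 2 μ),
      ⟪toL2 hμ f, u⟫_ℂ = ∫ x, u x * (starRingEnd ℂ) (f.1 x) ∂μ := by
    intro f u
    have := inner_toLp_eq (Lp.memLp u) (memLp_smooth hμ f).coeFn_toLp
    rwa [Lp.toLp_coeFn] at this
  refine ⟨hd, le_antisymm ?_ ?_⟩
  · rw [LinearPMap.adjoint_graph_eq_graph_adjoint hd]
    rintro ⟨u, v⟩ huv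
    rw [Submodule.mem_adjoint_iff] at huv
    have hdist : DistribEq P u v := by
      refine distribEq_of_forall_integral_eq hμ hP hsa (Lp.aestronglyMeasurable u)
        (Lp.aestronglyMeasurable v) fun f => ?_
      rw [← hinner, ← hinner]
      exact sub_eq_zero.1 (huv _ _ ((mem_graph_unbounded hμ).2 ⟨f, rfl⟩))
    have := mem_closure_graph_of_distribEq hμ hP (Lp.memLp u) (Lp.memLp v) hdist
    rwa [Lp.toLp_coeFn, Lp.toLp_coeFn] at this
  · refine Submodule.topologicalClosure_minimal _ ?_ (LinearPMap.adjoint_isClosed hd)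
    rw [LinearPMap.adjoint_graph_eq_graph_adjoint hd]
    intro p hp
    obtain ⟨f, rfl⟩ := (mem_graph_unbounded hμ).1 hp
    rw [Submodule.mem_adjoint_iff]
    intro x y hxy
    obtain ⟨g, hg⟩ := (mem_graph_unbounded hμ).1 hxy
    obtain ⟨rfl, rfl⟩ := Prod.mk.inj hg
    have hcoe : ∀ f g : Smooth n M, ⟪toL2 hμ f, toL2 hμ g⟫_ℂ
        = ∫ x, g.1 x * (starRingEnd ℂ) (f.1 x) ∂μ := fun f g =>
      inner_toLp_eq (memLp_smooth hμ g) (memLp_smooth hμ f).coeFn_toLp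
    rw [hcoe, hcoe, sub_eq_zero]
    exact (hsa f g).symm

end Adjoint

end FirstOrder

theorem mainTheorem3 (n : ℕ) (M : Type*) [TopologicalSpace M] [T2Space M] [CompactSpace M]
    [ChartedSpace (EuclideanSpace ℝ (Fin n)) M] [IsManifold (𝓡 n) ∞ M]
    [MeasurableSpace M] [BorelSpace M]
    (μ : Measure M) (hμ : FirstOrder.IsSmoothDensity n μ)
    (P : FirstOrder.Smooth n M →ₗ[ℂ] FirstOrder.Smooth n M)
    (hP : FirstOrder.IsDiffOpDegreeOne P) :
    (∀ u v : Lp ℂ 2 μ, FirstOrder.DistribEq P u v →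
      ∃ w : ℕ → FirstOrder.Smooth n M,
        Tendsto (fun j => FirstOrder.toL2 hμ (w j)) atTop (𝓝 u) ∧
        Tendsto (fun j => FirstOrder.toL2 hμ (P (w j))) atTop (𝓝 v)) ∧
    (FirstOrder.IsFormallySelfAdjoint μ P →
      FirstOrder.IsEssentiallySelfAdjoint (FirstOrder.unbounded hμ P)) := by
  refine ⟨fun u v huv => ?_, FirstOrder.isEssentiallySelfAdjoint_unbounded hμ hP⟩
  have hmem := FirstOrder.mem_closure_graph_of_distribEq hμ hP (Lp.memLp u) (Lp.memLp v) huv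
  rw [Lp.toLp_coeFn, Lp.toLp_coeFn] at hmem
  obtain ⟨x, hx, hlim⟩ := mem_closure_iff_seq_limit.1 hmem
  choose w hw using fun j => (FirstOrder.mem_graph_unbounded hμ).1 (hx j)
  obtain rfl : x = fun j => (FirstOrder.toL2 hμ (w j), FirstOrder.toL2 hμ (P (w j))) := funext hw
  exact ⟨w, (Prod.tendsto_iff _ _).1 hlim⟩
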